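/- **Theorem.** There is an absolute constant $K>0$ such that the following holds. Let $d\ge 0$, let $S_q\subset\mathbb R^d$ be a set of $N$ points and $C\subset\mathbb R^d$ a set of $k$ centroids, $1\le k\le N$, with the Euclidean metric. Let $\mathscr T_q$ be a cover tree on $S_q$ and $\mathscr T_r$ a cover tree on $C$. Then the dual-tree traversal step of $k$-means (described below) with query tree $\mathscr T_q$ and reference tree $\mathscr T_r$, started with valid upper bounds, takes time at most $$K\,c_k^4\,c_{qk}^5\,\bigl(N+i_t(\mathscr T_q)\bigr).$$ *Expansion constants.* For a finite set $S$ let $B_S(p,\Delta)=\{r\in S: d(p,r)\le\Delta\}$. The expansion constant of $S$ is the smallest $c\ge2$ with $|B_S(p,2\Delta)|\le c\,|B_S(p,\Delta)|$ for all $p\in S$, $\Delta>0$. Here $c_k$ is the expansion constant of $C$, and $c_{qk}$ is the maximum of $c_k$ and the expansion constants of the sets $C\cup\{p_q\}$, $p_q\in S_q$. *Cover trees.* A cover tree on $S$ is a rooted tree in which each node $\mathscr N$ holds one point $p$ and has a scale $s$, an integer for a non-leaf and $-\infty$ for a leaf. The points held are exactly those of $S$. Each non-leaf has at least two children (chains of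 single children are not stored), all of smaller scale; one of them holds the same point as the node (nesting), and the point of every child of a node of scale $s$ is within distance $2^{s}$ of the node's point (covering). For each integer $j$, let the nodes at level $j$ be the nodes of scale at most $j$ all of whose proper ancestors have scale greater than $j$; the points of distinct nodes at level $j$ are at distance greater than $2^j$ (separation). The imbalance $i_t(\mathscr T)$ is the sum over the non-root nodes of $s_p-s-1$ for a non-leaf of scale $s$ and of $\max(s_p-s_{\min}-1,0)$ for a leaf, where $s_p$ is the scale of the parent and $s_{\min}$ the smallest scale of a non-leaf. The descendant points $\mathscr D^p$ of a node are the points held in its subtree. The radius of a node is $2^{s+1}$ ($0$ for a leaf). *State.* Each query node $\mathscr N_q$ has values $\mathrm{ub}$, $\mathrm{lb}$, $\mathrm{closest}$ and a set of pruned centroids, of size $\mathrm{pruned}(\mathscr N_q)$; each query point has $\mathrm{ub},\mathrm{lb},\mathrm{closest}$. At the start no node is visited, the pruned sets are empty, and each $\mathrm{ub}(\mathscr N_q)$, possibly $\infty$, is an upper bound on the distance of each descendant point of $\mathscr N_q$ to its nearest centroid. *BaseCase$(p_q,c_r)$.* If $d(p_q,c_r)<\mathrm{ub}(p_q)$, set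 $\mathrm{lb}(p_q)\gets\mathrm{ub}(p_q)$, $\mathrm{ub}(p_q)\gets d(p_q,c_r)$, $\mathrm{closest}(p_q)\gets c_r$; else if $d(p_q,c_r)<\mathrm{lb}(p_q)$, set $\mathrm{lb}(p_q)\gets d(p_q,c_r)$. *Score$(\mathscr N_q,\mathscr N_r)$.* If $\mathscr N_q$ is visited for the first time and is not the root, copy the pruned set and $\mathrm{lb}$ from its parent. If $\mathrm{pruned}(\mathscr N_q)=k-1$, return $\infty$. Take any descendant centroid $c$ of $\mathscr N_r$. If $d_{\min}(\mathscr N_q,\mathscr N_r)>\mathrm{ub}(\mathscr N_q)$, lower $\mathrm{lb}(\mathscr N_q)$ to $d_{\min}(\mathscr N_q,\mathscr N_r)$ if that is smaller, add the descendant centroids of $\mathscr N_r$ to the pruned set of $\mathscr N_q$, and return $\infty$. Otherwise, if $d_{\max}(\mathscr N_q,c)<\mathrm{ub}(\mathscr N_q)$, set $\mathrm{ub}(\mathscr N_q)\gets d_{\max}(\mathscr N_q,c)$ and $\mathrm{closest}(\mathscr N_q)\gets c$; then return $\infty$ if $\mathrm{pruned}(\mathscr N_q)=k-1$, and $d_{\min}(\mathscr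 N_q,\mathscr N_r)$ if not. Here $d_{\min}$ and $d_{\max}$ are any valid lower and upper bounds on the distances between descendant points (respectively between descendant points and $c$) that are at least as tight as those from the bounding balls, $d(p_q,p_r)-\mathrm{rad}(\mathscr N_q)-\mathrm{rad}(\mathscr N_r)$ and $d(p_q,c)+\mathrm{rad}(\mathscr N_q)$; the exact minimum and maximum are allowed. *Traversal.* Score the pair of roots; call the following procedure with the query root and the set $R$ that contains the reference root if that pair was not pruned, and is empty otherwise. For $(\mathscr N_q,R)$: call BaseCase on the point of $\mathscr N_q$ and the point of each element of $R$. Let $s^{\max}$ be the largest scale in $R$. If $s_q<s^{\max}$, replace the elements of $R$ of scale $s^{\max}$ by their children, score $\mathscr N_q$ against the result, and recurse with $\mathscr N_q$ and the nodes whose score is not $\infty$. Otherwise, if $R\ne\emptyset$, for each child $\mathscr N_{qc}$ of $\mathscr N_q$ in turn, score $\mathscr N_{qc}$ against $R$ and recurse with $\mathscr N_{qc}$ and the nodes whose score is not $\infty$. Sets are run through in any order. *Time.* Each call of BaseCase and of Score takes one unit; each call of the recursive procedure takes, in addition, $1+2|R|$ units. -/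

import Mathlib

namespace DualTreeKMeans

/-- Rooted trees whose nodes hold one point each. A leaf has scale `-∞`; every other node has an
integer scale `s` and `n` children. A node is identified with the subtree that it roots. -/
inductive CTree (E : Type) : Type
  | leaf (p : E) : CTree E
  | node (p : E) (s : ℤ) (n : ℕ) (ch : Fin n → CTree E) : CTree E

namespace CTree

variable {E : Type}

/-- The point held by a node. -/
def pt : CTree E → E
  | leaf p => p
  | node p _ _ _ => p

/-- The scale of a node; `⊥` is `-∞`. -/
def scale : CTree E → WithBot ℤ
  | leaf _ => ⊥
  | node _ s _ _ => (s : WithBot ℤ)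

/-- The children of a node. -/
def children : CTree E → List (CTree E)
  | leaf _ => []
  | node _ _ _ ch => List.ofFn ch

/-- The radius `2 ^ (s + 1)` of the bounding ball of a node of scale `s`; it is `0` for a leaf. -/
noncomputable def radius : CTree E → ℝ
  | leaf _ => 0
  | node _ s _ _ => (2 : ℝ) ^ (s + 1)

/-- All nodes of the tree, the root included. -/
def nodes : CTree E → List (CTree E)
  | leaf p => [leaf p]
  | node p s n ch => node p s n ch :: (List.ofFn fun i => nodes (ch i)).flatten

/-- The number of nodes. -/
def size : CTree E → ℕ
  | leaf _ => 1
  | node _ _ _ ch => 1 + ∑ i, size (ch i)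

open scoped Classical in
/-- The descendant points of a node: the points held by the nodes of its subtree. -/
noncomputable def points (T : CTree E) : Finset E := (T.nodes.map pt).toFinset

/-- The points present at level `j` of the leveled tree. Chains of nodes without any child other
than the self-child are not stored, so a stored node of scale `s` whose parent has scale `s'`
stands for the levels `j` with `s ≤ j < s'`. -/
def level (j : ℤ) : CTree E → List E
  | leaf p => [p]
  | node p s _ ch => if s ≤ j then [p] else (List.ofFn fun i => level j (ch i)).flatten

/-- Nesting and covering, for a tree in which nodes with a single child are not stored: the scales
decrease, one child holds the same point as its parent, and a child of a node of scale `s` (which is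
present at level `s - 1`) has its point within `2 ^ s` of the parent's point. -/
def NestedCovering [MetricSpace E] : CTree E → Prop
  | leaf _ => True
  | node p s n ch =>
      2 ≤ n ∧ (∃ i, (ch i).pt = p) ∧ (∀ i, (ch i).scale < (s : WithBot ℤ)) ∧
        (∀ i, dist (ch i).pt p ≤ (2 : ℝ) ^ s) ∧ ∀ i, NestedCovering (ch i)

/-- `T` is a cover tree on the point set `S`. The second clause is separation: the points present
at level `j` are distinct and more than `2 ^ j` apart. -/
def IsCoverTree [MetricSpace E] (S : Finset E) (T : CTree E) : Prop :=
  T.NestedCovering ∧ (∀ j : ℤ, (T.level j).Pairwise fun x y => (2 : ℝ) ^ j < dist x y) ∧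
    T.points = S

/-- The smallest scale of a node that is not a leaf. -/
noncomputable def minScale (T : CTree E) : ℤ :=
  sInf {s : ℤ | ∃ N ∈ T.nodes, N.scale = (s : WithBot ℤ)}

/-- The node imbalance of a node whose parent has scale `sp`, in a tree with smallest non-leaf
scale `smin`. -/
def nodeImbalance (smin sp : ℤ) : CTree E → ℤ
  | leaf _ => max (sp - smin - 1) 0
  | node _ s _ _ => sp - s - 1

/-- The sum of the node imbalances of all proper descendants. -/
def imbalanceBelow (smin : ℤ) : CTree E → ℤ
  | leaf _ => 0
  | node _ s _ ch => ∑ i, (nodeImbalance smin s (ch i) + imbalanceBelow smin (ch i))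

/-- The cover tree imbalance: the sum of the node imbalances over all nodes, where that of the
root is `0`. -/
noncomputable def imbalance (T : CTree E) : ℤ := imbalanceBelow T.minScale T

end CTree

open scoped Classical in
/-- The number of points of `S` in the closed ball of radius `Δ` around `p`. -/
noncomputable def ballCount {E : Type} [MetricSpace E] (S : Finset E) (p : E) (Δ : ℝ) : ℕ :=
  (S.filter fun r => dist p r ≤ Δ).card

/-- The expansion constant of `S`: the smallest `c ≥ 2` with `|B(p, 2Δ)| ≤ c |B(p, Δ)|` for all
`p ∈ S` and `Δ > 0`. -/
noncomputable def expansionConstant {E : Type} [MetricSpace E] (S : Finset E) : ℝ :=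
  sInf {c : ℝ | 2 ≤ c ∧ ∀ p ∈ S, ∀ Δ : ℝ, 0 < Δ →
    (ballCount S p (2 * Δ) : ℝ) ≤ c * (ballCount S p Δ : ℝ)}

open scoped Classical in
/-- The largest expansion constant among `C` and the sets `C ∪ {q}`, `q ∈ S`. -/
noncomputable def jointExpansionConstant {E : Type} [MetricSpace E] (S C : Finset E) : ℝ :=
  max (⨆ q : S, expansionConstant (insert (q : E) C)) (expansionConstant C)

/-- What the algorithm leaves open, for a query tree `Tq` and a reference tree `Tr`: the order in
which a set of reference nodes is run through, the descendant centroid `c` taken in `Score`, and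
the evaluation of `d_min` and `d_max`. The latter may be the exact values over the descendant
points, the values for the bounding balls, or anything in between. -/
structure Implementation {E : Type} [MetricSpace E] (Tq Tr : CTree E) where
  order : CTree E → List (CTree E) → List (CTree E)
  order_perm : ∀ Nq R, (order Nq R).Perm R
  pick : CTree E → CTree E → E
  pick_mem : ∀ Nq ∈ Tq.nodes, ∀ Nr ∈ Tr.nodes, pick Nq Nr ∈ Nr.points
  dmin : CTree E → CTree E → ℝ
  dmin_le : ∀ Nq ∈ Tq.nodes, ∀ Nr ∈ Tr.nodes, ∀ x ∈ Nq.points, ∀ y ∈ Nr.points,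
    dmin Nq Nr ≤ dist x y
  le_dmin : ∀ Nq ∈ Tq.nodes, ∀ Nr ∈ Tr.nodes,
    dist Nq.pt Nr.pt - Nq.radius - Nr.radius ≤ dmin Nq Nr
  dmax : CTree E → E → ℝ
  le_dmax : ∀ Nq ∈ Tq.nodes, ∀ c ∈ Tr.points, ∀ x ∈ Nq.points, dist x c ≤ dmax Nq c
  dmax_le : ∀ Nq ∈ Tq.nodes, ∀ c ∈ Tr.points, dmax Nq c ≤ dist Nq.pt c + Nq.radius

/-- The quantities that the traversal maintains for query nodes and query points. `pruned Nq` is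
the set of centroids pruned for `Nq`, so that its cardinality is the number called `pruned(Nq)` and
no centroid is counted twice. `none` is the invalid centroid. `steps` is the elapsed time. -/
structure State (E : Type) where
  ub : CTree E → EReal
  lb : CTree E → EReal
  pruned : CTree E → Finset E
  closest : CTree E → Option E
  visited : Set (CTree E)
  ubPt : E → EReal
  lbPt : E → EReal
  closestPt : E → Option E
  steps : ℕ

/-- A legitimate state at the start of a traversal: nothing is visited or pruned, and `ub Nq` is an
upper bound (possibly infinite, possibly known from an earlier iteration) on the distance between
any descendant point of `Nq` and the centroid nearest to it. -/
def State.Valid {E : Type} [MetricSpace E] (Tq : CTree E) (C : Finset E) (st : State E) : Prop :=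
  st.visited = ∅ ∧ (∀ Nq, st.pruned Nq = ∅) ∧
    ∀ Nq ∈ Tq.nodes, ∀ x ∈ Nq.points, ∃ c ∈ C, ((dist x c : ℝ) : EReal) ≤ st.ub Nq

/-- Let `t` time units pass. -/
def State.tick {E : Type} (t : ℕ) (st : State E) : State E := { st with steps := st.steps + t }

section ReferenceNodes

variable {E : Type}

/-- The largest scale in a set of reference nodes. -/
def maxScale (R : List (CTree E)) : WithBot ℤ := (R.map CTree.scale).foldr max ⊥

open scoped Classical in
/-- Replace the reference nodes of scale `m` by their children. -/
noncomputable def expand (m : WithBot ℤ) (R : List (CTree E)) : List (CTree E) :=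
  R.flatMap fun Nr => if Nr.scale = m then Nr.children else [Nr]

/-- The total number of nodes in a list of subtrees. -/
def totalSize (R : List (CTree E)) : ℕ := (R.map CTree.size).sum

theorem exists_scale_eq_maxScale (R : List (CTree E)) (h : ⊥ < maxScale R) :
    ∃ N ∈ R, N.scale = maxScale R := by
  induction R with
  | nil => simp [maxScale] at h
  | cons a L ih =>
    have e : maxScale (a :: L) = max a.scale (maxScale L) := rfl
    rcases le_total (maxScale L) a.scale with h1 | h1
    · exact ⟨a, by simp, by rw [e, max_eq_left h1]⟩
    · rw [e, max_eq_right h1] at h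
      obtain ⟨N, hN, hs⟩ := ih h
      exact ⟨N, by simp [hN], by rw [e, max_eq_right h1, hs]⟩

theorem totalSize_expand_lt (R : List (CTree E)) (h : ⊥ < maxScale R) :
    totalSize (expand (maxScale R) R) < totalSize R := by
  classical
  obtain ⟨N, hN, hs⟩ := exists_scale_eq_maxScale R h
  revert hs h
  generalize maxScale R = m
  intro hm hs
  have key : ∀ Nr : CTree E, Nr.scale = m → totalSize Nr.children < Nr.size := by
    intro Nr h
    cases Nr with
    | leaf p => simp only [CTree.scale] at h; exact absurd h hm.ne
    | node p s n ch =>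
      simp [totalSize, CTree.children, CTree.size, List.map_ofFn, List.sum_ofFn]
  have cons : ∀ (a : CTree E) (L : List (CTree E)), totalSize (expand m (a :: L)) =
      totalSize (if a.scale = m then a.children else [a]) + totalSize (expand m L) := by
    intro a L
    simp [expand, totalSize]
  have cons' : ∀ (a : CTree E) (L : List (CTree E)),
      totalSize (a :: L) = a.size + totalSize L := by
    intro a L
    simp [totalSize]
  have one : ∀ a : CTree E,
      totalSize (if a.scale = m then a.children else [a]) ≤ a.size := by
    intro a
    split_ifs with h
    · exact (key a h).le
    · simp [totalSize]
  have le : ∀ L : List (CTree E), totalSize (expand m L) ≤ totalSize L := by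
    intro L
    induction L with
    | nil => simp [expand]
    | cons a L ih =>
      rw [cons, cons']
      exact Nat.add_le_add (one a) ih
  induction R with
  | nil => simp at hN
  | cons a L ih =>
    rw [cons, cons']
    rcases List.mem_cons.1 hN with rfl | hN
    · rw [if_pos hs]
      exact Nat.add_lt_add_of_lt_of_le (key _ hs) (le L)
    · exact Nat.add_lt_add_of_le_of_lt (one a) (ih hN)

end ReferenceNodes

section Algorithm

variable {E : Type} [MetricSpace E] {Tq Tr : CTree E}

open scoped Classical in
/-- `BaseCase(p, c)`; it takes one time unit. -/
noncomputable def baseCase (p c : E) (st₀ : State E) : State E :=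
  let st := st₀.tick 1
  let d : EReal := ((dist p c : ℝ) : EReal)
  if d < st.ubPt p then
    { st with
      lbPt := Function.update st.lbPt p (st.ubPt p)
      ubPt := Function.update st.ubPt p d
      closestPt := Function.update st.closestPt p (some c) }
  else if d < st.lbPt p then
    { st with lbPt := Function.update st.lbPt p d }
  else st

open scoped Classical in
/-- The first stanza of `Score`: a query node that is visited for the first time and is not the
root takes over `pruned` and `lb` from its parent (`none` for the root). -/
noncomputable def enter (par : Option (CTree E)) (Nq : CTree E) (st : State E) : State E :=
  if Nq ∈ st.visited then st
  else
    match par with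
    | none => { st with visited := insert Nq st.visited }
    | some P =>
      { st with
        visited := insert Nq st.visited
        pruned := Function.update st.pruned Nq (st.pruned P)
        lb := Function.update st.lb Nq (st.lb P) }

open scoped Classical in
/-- The middle part of `Score`: prune by the distance bound, or else try to improve the upper
bound. -/
noncomputable def compareBounds (A : Implementation Tq Tr) (Nq Nr : CTree E) (st : State E) :
    EReal × State E :=
  let c := A.pick Nq Nr
  let dmin : EReal := ((A.dmin Nq Nr : ℝ) : EReal)
  let dmax : EReal := ((A.dmax Nq c : ℝ) : EReal)
  if st.ub Nq < dmin then
    (⊤, { st with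
          lb := if dmin < st.lb Nq then Function.update st.lb Nq dmin else st.lb
          pruned := Function.update st.pruned Nq (st.pruned Nq ∪ Nr.points) })
  else if dmax < st.ub Nq then
    (dmin, { st with
          ub := Function.update st.ub Nq dmax
          closest := Function.update st.closest Nq (some c) })
  else (dmin, st)

/-- `Score(Nq, Nr)` with `k` centroids, for a query node with parent `par`; the value `⊤` means
that the combination is pruned. It takes one time unit. -/
noncomputable def score (A : Implementation Tq Tr) (k : ℕ) (par : Option (CTree E))
    (Nq Nr : CTree E) (st₀ : State E) : EReal × State E :=
  let st := enter par Nq (st₀.tick 1)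
  if (st.pruned Nq).card + 1 = k then (⊤, st)
  else
    let res := compareBounds A Nq Nr st
    if (res.2.pruned Nq).card + 1 = k then (⊤, res.2) else res

open scoped Classical in
/-- Score `Nq` against a list of reference nodes, one after the other, and return those that are
not pruned. -/
noncomputable def scoreAll (A : Implementation Tq Tr) (k : ℕ) (par : Option (CTree E))
    (Nq : CTree E) : List (CTree E) → State E → List (CTree E) × State E
  | [], st => ([], st)
  | Nr :: R, st =>
    let res := score A k par Nq Nr st
    let rest := scoreAll A k par Nq R res.2
    (if res.1 = ⊤ then rest.1 else Nr :: rest.1, rest.2)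

theorem scoreAll_sublist (A : Implementation Tq Tr) (k : ℕ) (par : Option (CTree E))
    (Nq : CTree E) (R : List (CTree E)) (st : State E) :
    (scoreAll A k par Nq R st).1.Sublist R := by
  induction R generalizing st with
  | nil => simp [scoreAll]
  | cons Nr R ih =>
    simp only [scoreAll]
    split_ifs
    · exact (ih _).cons _
    · exact (ih _).cons_cons _

theorem totalSize_scoreAll_order_le (A : Implementation Tq Tr) (k : ℕ) (par : Option (CTree E))
    (Nq : CTree E) (R : List (CTree E)) (st : State E) :
    totalSize (scoreAll A k par Nq (A.order Nq R) st).1 ≤ totalSize R := by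
  have h1 := ((scoreAll_sublist A k par Nq (A.order Nq R) st).map CTree.size).sum_le_sum
    (fun _ _ => Nat.zero_le _)
  have h2 := ((A.order_perm Nq R).map CTree.size).sum_eq
  unfold totalSize
  omega

/-- Call `baseCase` on the point of `Nq` and the point of each element of `R`. -/
noncomputable def baseCases (Nq : CTree E) (R : List (CTree E)) (st₀ : State E) : State E :=
  R.foldl (fun st Nr => baseCase Nq.pt Nr.pt st) st₀

/-- The standard pruning dual-tree traversal for cover trees, called with a query node `Nq`
with parent `par` and a list `R` of reference nodes that have been scored against `Nq` and were not
pruned. If some reference node has a larger scale than `Nq`, the reference nodes of the largest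
scale are replaced by their children and the result is scored against `Nq`; otherwise `R` is
scored against each child of `Nq` in turn. A call takes one time unit, two further units per
element of `R` (to find the largest scale and the nodes that have it), and the time of its calls of
`baseCase`, `score` and `traverse`. -/
noncomputable def traverse (A : Implementation Tq Tr) (k : ℕ) (par : Option (CTree E)) :
    (Nq : CTree E) → (R : List (CTree E)) → State E → State E
  | Nq, R, st₀ =>
    let st := baseCases Nq R (st₀.tick (1 + 2 * R.length))
    if h : Nq.scale < maxScale R then
      let res := scoreAll A k par Nq (A.order Nq (expand (maxScale R) R)) st
      traverse A k par Nq res.1 res.2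
    else if R = [] then st
    else
      match Nq with
      | .leaf _ => st
      | .node p s n ch =>
        (List.finRange n).foldl (fun st i =>
          let res := scoreAll A k (some (.node p s n ch)) (ch i) (A.order (ch i) R) st
          traverse A k (some (.node p s n ch)) (ch i) res.1 res.2) st
  termination_by Nq R => Nq.size + totalSize R
  decreasing_by
    · exact Nat.add_lt_add_left (lt_of_le_of_lt (totalSize_scoreAll_order_le A k par Nq _ _)
        (totalSize_expand_lt R (lt_of_le_of_lt bot_le h))) _
    · have h2 := totalSize_scoreAll_order_le A k (some (.node p s n ch)) (ch i) R st
      have h3 : (ch i).size ≤ ∑ j, (ch j).size :=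
        Finset.single_le_sum (f := fun j => (ch j).size) (fun _ _ => Nat.zero_le _)
          (Finset.mem_univ i)
      simp only [CTree.size]
      omega

/-- The dual-tree traversal step of `k`-means: score the two roots and start the traversal. -/
noncomputable def dualTreeStep (A : Implementation Tq Tr) (k : ℕ) (st₀ : State E) : State E :=
  let res := scoreAll A k none Tq [Tr] { st₀ with steps := 0 }
  traverse A k none Tq res.1 res.2

/-- The running time of the dual-tree traversal step. -/
noncomputable def runningTime (A : Implementation Tq Tr) (k : ℕ) (st₀ : State E) : ℕ :=
  (dualTreeStep A k st₀).steps

end Algorithm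

end DualTreeKMeans

/-! The time is the number of calls of `traverse` times the cost of one call. Write c for the
expansion constant of C and e for the joint one; c ≤ e.

Cost of a call. Let q be the point of the query node, D its distance to C, and M the largest scale
in the list before an expansion. As long as fewer than k - 1 centroids are pruned, the list covers
the centroid nearest to q, because a valid `ub` never discards it. The node covering it was not
pruned, so `ub` is at most `dmax` for the centroid picked from it, and every survivor of the next
scoring has its point within D + 7 * 2^M of q. These points are more than 2^(M-1) apart. If D < 3 *
2^M, packing inside C leaves at most 9c^6 of them. If D ≥ 3 * 2^M, the ball of radius D/2 about q in
C ∪ {q} contains q alone, and three doublings give e^3. By packing, a node has at most 9c^3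
children. A call thus costs O(c^9 + c^3 e^3), which is O(c^4 e^5). Once k - 1 centroids are pruned,
every score is infinite and the next list is empty.

The exponents rely on a packing bound with overlapping balls: their radius is two thirds of the
separation instead of one half, and no point lies in more than nine of them, in any dimension. This
saves one doubling in each of the two packings.

Number of calls. A non-leaf query node of scale t below a parent of scale s sees at most s - t
reference recursions, its imbalance plus one. A leaf sees about its imbalance many down to level L,
six below the smallest non-leaf query scale. Below L there are two cases. If D ≥ 8 * 2^M, all
remaining reference subtrees together have at most 2e^2 nodes, and even a quadratic bound on the
remaining time fits the cost of one call. Otherwise the list stays within 2^(L+4) of q, and each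
recursion is charged to a reference node of the current largest scale in that ball. Leaf points of
the query tree are so far apart that these balls are disjoint, so all such charges add up to at most
the number of reference nodes, which is below 2k ≤ 2N. Recursions at the query root are bounded by
the same number (`traverse_leaf_within`, `traverse_scale_within`, `work_le`, `runningTime_le`). -/

namespace DualTreeKMeans

section
-- Combinatorics of trees and their levels
namespace CTree

variable {E : Type}

/-- The points held by the leaves. -/
def leaves : CTree E → List E
  | leaf p => [p]
  | node _ _ _ ch => (List.ofFn fun i => leaves (ch i)).flatten

/-- The nodes of scale at most `j` whose proper ancestors have scale greater than `j`. -/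
def levelNodes (j : ℤ) : CTree E → List (CTree E)
  | leaf p => [leaf p]
  | node p s n ch =>
      if s ≤ j then [node p s n ch] else (List.ofFn fun i => levelNodes j (ch i)).flatten

theorem mem_flatten_ofFn {α : Type*} {n : ℕ} {f : Fin n → List α} {a : α} :
    a ∈ (List.ofFn f).flatten ↔ ∃ i, a ∈ f i := by
  simp [List.mem_flatten, List.mem_ofFn]

theorem sublist_flatten_ofFn {α : Type*} {n : ℕ} (f : Fin n → List α) (i : Fin n) :
    (f i).Sublist (List.ofFn f).flatten :=
  List.sublist_flatten_of_mem (List.mem_ofFn.2 ⟨i, rfl⟩)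

theorem mem_nodes_node {p : E} {s : ℤ} {n : ℕ} {ch : Fin n → CTree E} {N : CTree E} :
    N ∈ (node p s n ch).nodes ↔ N = node p s n ch ∨ ∃ i, N ∈ (ch i).nodes := by
  rw [nodes, List.mem_cons, mem_flatten_ofFn]

theorem self_mem_nodes (T : CTree E) : T ∈ T.nodes := by
  cases T <;> simp [nodes]

theorem child_mem_nodes {p : E} {s : ℤ} {n : ℕ} {ch : Fin n → CTree E} (i : Fin n) :
    ch i ∈ (node p s n ch).nodes :=
  mem_nodes_node.2 (Or.inr ⟨i, self_mem_nodes _⟩)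

theorem mem_nodes_trans {T N M : CTree E} (hN : N ∈ T.nodes) (hM : M ∈ N.nodes) :
    M ∈ T.nodes := by
  induction T with
  | leaf p => simp only [nodes, List.mem_singleton] at hN; subst hN; exact hM
  | node p s n ch ih =>
    rcases mem_nodes_node.1 hN with rfl | ⟨i, hi⟩
    · exact hM
    · exact mem_nodes_node.2 (Or.inr ⟨i, ih i hi⟩)

theorem size_child_lt {p : E} {s : ℤ} {n : ℕ} {ch : Fin n → CTree E} (i : Fin n) :
    (ch i).size < (node p s n ch).size := by
  have h3 : (ch i).size ≤ ∑ j, (ch j).size :=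
    Finset.single_le_sum (f := fun j => (ch j).size) (fun _ _ => Nat.zero_le _) (Finset.mem_univ i)
  simp only [size]
  omega

theorem size_le_of_mem_nodes {T N : CTree E} (hN : N ∈ T.nodes) : N.size ≤ T.size := by
  induction T with
  | leaf p => simp only [nodes, List.mem_singleton] at hN; subst hN; exact le_rfl
  | node p s n ch ih =>
    rcases mem_nodes_node.1 hN with rfl | ⟨i, hi⟩
    · exact le_rfl
    · exact (ih i hi).trans (size_child_lt i).le

theorem notMem_nodes_child {p : E} {s : ℤ} {n : ℕ} {ch : Fin n → CTree E} (i : Fin n) :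
    node p s n ch ∉ (ch i).nodes := fun h =>
  absurd (size_le_of_mem_nodes h) (size_child_lt i).not_ge

theorem one_le_size (T : CTree E) : 1 ≤ T.size := by
  cases T <;> simp [size]

theorem leaves_sublist {T N : CTree E} (hN : N ∈ T.nodes) : N.leaves.Sublist T.leaves := by
  induction T with
  | leaf p => simp only [nodes, List.mem_singleton] at hN; subst hN; exact .refl _
  | node p s n ch ih =>
    rcases mem_nodes_node.1 hN with rfl | ⟨i, hi⟩
    · exact .refl _
    · rw [leaves]
      exact (ih i hi).trans (sublist_flatten_ofFn (fun i => (ch i).leaves) i)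

theorem length_nodes (T : CTree E) : T.nodes.length = T.size := by
  induction T with
  | leaf p => simp [nodes, size]
  | node p s n ch ih =>
    simp [nodes, size, ih, List.map_ofFn, List.sum_ofFn, Function.comp_def, add_comm]

theorem levelNodes_map_pt (j : ℤ) (T : CTree E) : (T.levelNodes j).map pt = T.level j := by
  induction T with
  | leaf p => simp [levelNodes, level, pt]
  | node p s n ch ih =>
    rw [levelNodes, level]
    split_ifs
    · simp [pt]
    · simp [List.map_flatten, List.map_ofFn, Function.comp_def, ih]

theorem levelNodes_subset_nodes (j : ℤ) (T : CTree E) : ∀ N ∈ T.levelNodes j, N ∈ T.nodes := by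
  induction T with
  | leaf p => simp [levelNodes, nodes]
  | node p s n ch ih =>
    intro N hN
    rw [levelNodes] at hN
    split_ifs at hN
    · rw [List.mem_singleton] at hN; subst hN; exact self_mem_nodes _
    · obtain ⟨i, hi⟩ := mem_flatten_ofFn.1 hN
      exact mem_nodes_node.2 (Or.inr ⟨i, ih i N hi⟩)

theorem scale_le_of_mem_levelNodes (j : ℤ) (T : CTree E) :
    ∀ N ∈ T.levelNodes j, N.scale ≤ (j : WithBot ℤ) := by
  induction T with
  | leaf p => simp [levelNodes, scale]
  | node p s n ch ih =>
    intro N hN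
    rw [levelNodes] at hN
    split_ifs at hN with h
    · rw [List.mem_singleton] at hN; subst hN; exact WithBot.coe_le_coe.2 h
    · obtain ⟨i, hi⟩ := mem_flatten_ofFn.1 hN
      exact ih i N hi

theorem levelNodes_eq_self {j : ℤ} {T : CTree E} (h : T.scale ≤ (j : WithBot ℤ)) :
    T.levelNodes j = [T] := by
  cases T with
  | leaf p => rfl
  | node p s n ch =>
    rw [levelNodes, if_pos (WithBot.coe_le_coe.1 h)]

theorem flatMap_flatten_ofFn {α β : Type*} {n : ℕ} (f : Fin n → List α) (g : α → List β) :
    (List.ofFn f).flatten.flatMap g = (List.ofFn fun i => (f i).flatMap g).flatten := by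
  induction n with
  | zero => simp
  | succ n ih => simp [List.ofFn_succ, List.flatMap_append, ih]

theorem sublist_flatten_ofFn_of_forall {α : Type*} {n : ℕ} {f g : Fin n → List α}
    (h : ∀ i, (f i).Sublist (g i)) : (List.ofFn f).flatten.Sublist (List.ofFn g).flatten := by
  induction n with
  | zero => simp
  | succ n ih =>
    simp only [List.ofFn_succ, List.flatten_cons]
    exact (h 0).append (ih fun i => h i.succ)

theorem filter_flatten_ofFn {α : Type*} {n : ℕ} (f : Fin n → List α) (q : α → Bool) :
    (List.ofFn f).flatten.filter q = (List.ofFn fun i => (f i).filter q).flatten := by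
  induction n with
  | zero => simp
  | succ n ih => simp [List.ofFn_succ, ih]

open scoped Classical in
-- The proper ancestors of a node at level `j` have scale above `j`, hence above `j'`; so a node
-- already of scale at most `j'` is still present there.
theorem filter_levelNodes_sublist {j j' : ℤ} (hj : j' ≤ j) (T : CTree E) :
    ((T.levelNodes j).filter fun N => N.scale ≤ (j' : WithBot ℤ)).Sublist (T.levelNodes j') := by
  induction T with
  | leaf p => simp [levelNodes, scale]
  | node p s n ch ih =>
    rw [levelNodes, levelNodes]
    by_cases h : s ≤ j
    · rw [if_pos h]
      by_cases h' : s ≤ j'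
      · rw [if_pos h']; exact List.filter_sublist
      · rw [List.filter_singleton, if_neg h']
        simp [scale, h']
    · rw [if_neg h, if_neg (fun h' => h (h'.trans hj)), filter_flatten_ofFn]
      exact sublist_flatten_ofFn_of_forall ih

/-- A level cuts every path from the root to a leaf exactly once. -/
theorem flatMap_leaves_levelNodes (j : ℤ) (T : CTree E) :
    (T.levelNodes j).flatMap leaves = T.leaves := by
  induction T with
  | leaf p => simp [levelNodes]
  | node p s n ch ih =>
    rw [levelNodes]
    split_ifs
    · simp
    · rw [flatMap_flatten_ofFn, leaves]; simp only [ih]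

theorem level_eq_leaves {j : ℤ} {T : CTree E}
    (h : ∀ N ∈ T.nodes, ∀ s : ℤ, N.scale = (s : WithBot ℤ) → j < s) : T.level j = T.leaves := by
  induction T with
  | leaf p => rfl
  | node p s n ch ih =>
    rw [level, leaves, if_neg (h _ (self_mem_nodes _) s rfl).not_ge]
    congr 2
    funext i
    exact ih i fun N hN => h N (mem_nodes_node.2 (Or.inr ⟨i, hN⟩))

theorem exists_forall_lt_scale (T : CTree E) :
    ∃ j : ℤ, ∀ N ∈ T.nodes, ∀ s : ℤ, N.scale = (s : WithBot ℤ) → j < s := by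
  generalize T.nodes = L
  induction L with
  | nil => exact ⟨0, by simp⟩
  | cons a L ih =>
    obtain ⟨j, hj⟩ := ih
    cases a with
    | leaf p =>
      refine ⟨j, fun N hN s hs => ?_⟩
      rcases List.mem_cons.1 hN with rfl | hN
      · simp [scale] at hs
      · exact hj N hN s hs
    | node p t n ch =>
      refine ⟨min j (t - 1), fun N hN s hs => ?_⟩
      rcases List.mem_cons.1 hN with rfl | hN
      · have : t = s := WithBot.coe_injective hs
        omega
      · have := hj N hN s hs
        omega

/-- The tree is finite, so its scales are bounded below and the `sInf` in ℤ is meaningful. -/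
theorem minScale_le {T N : CTree E} (hN : N ∈ T.nodes) {s : ℤ} (hs : N.scale = (s : WithBot ℤ)) :
    T.minScale ≤ s := by
  obtain ⟨j, hj⟩ := exists_forall_lt_scale T
  refine csInf_le ⟨j, ?_⟩ ⟨N, hN, hs⟩
  rintro t ⟨M, hM, ht⟩
  exact (hj M hM t ht).le

theorem exists_node_of_mem_leaves {T : CTree E} {x : E} (hx : x ∈ T.leaves) : leaf x ∈ T.nodes := by
  induction T with
  | leaf p => simp only [leaves, List.mem_singleton] at hx; subst hx; exact self_mem_nodes _
  | node p s n ch ih =>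
    rw [leaves, mem_flatten_ofFn] at hx
    obtain ⟨i, hi⟩ := hx
    exact mem_nodes_node.2 (Or.inr ⟨i, ih i hi⟩)

theorem pt_mem_points (T : CTree E) : T.pt ∈ T.points := by
  simp only [points, List.mem_toFinset, List.mem_map]
  exact ⟨T, self_mem_nodes T, rfl⟩

theorem points_subset {T N : CTree E} (hN : N ∈ T.nodes) : N.points ⊆ T.points := by
  intro x
  simp only [points, List.mem_toFinset, List.mem_map]
  rintro ⟨M, hM, rfl⟩
  exact ⟨M, mem_nodes_trans hN hM, rfl⟩

theorem radius_le {T : CTree E} {s : ℤ} (h : T.scale ≤ (s : WithBot ℤ)) :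
    T.radius ≤ (2 : ℝ) ^ (s + 1) := by
  cases T with
  | leaf p => simp only [radius]; positivity
  | node p t n ch =>
    have : t ≤ s := WithBot.coe_le_coe.1 h
    exact zpow_le_zpow_right₀ one_le_two (by omega)

theorem radius_le_of_lt {T : CTree E} {s : ℤ} (h : T.scale < (s : WithBot ℤ)) :
    T.radius ≤ (2 : ℝ) ^ s := by
  cases T with
  | leaf p => simp only [radius]; positivity
  | node p t n ch =>
    have : t < s := WithBot.coe_lt_coe.1 h
    exact zpow_le_zpow_right₀ one_le_two (by omega)

/-! ### Nesting, covering and separation -/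

section Metric

variable [MetricSpace E]

theorem NestedCovering.of_mem_nodes {T N : CTree E} (h : T.NestedCovering) (hN : N ∈ T.nodes) :
    N.NestedCovering := by
  induction T with
  | leaf p => simp only [nodes, List.mem_singleton] at hN; subst hN; exact h
  | node p s n ch ih =>
    rcases mem_nodes_node.1 hN with rfl | ⟨i, hi⟩
    · exact h
    · exact ih i (h.2.2.2.2 i) hi

theorem scale_le_of_mem_nodes {T N : CTree E} (h : T.NestedCovering) (hN : N ∈ T.nodes) :
    N.scale ≤ T.scale := by
  induction T with
  | leaf p => simp only [nodes, List.mem_singleton] at hN; subst hN; exact le_rfl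
  | node p s n ch ih =>
    rcases mem_nodes_node.1 hN with rfl | ⟨i, hi⟩
    · exact le_rfl
    · exact (ih i (h.2.2.2.2 i) hi).trans (h.2.2.1 i).le

theorem pt_mem_leaves {T : CTree E} (h : T.NestedCovering) : T.pt ∈ T.leaves := by
  induction T with
  | leaf p => simp [leaves, pt]
  | node p s n ch ih =>
    obtain ⟨i, hi⟩ := h.2.1
    rw [leaves, mem_flatten_ofFn]
    exact ⟨i, by rw [pt, ← hi]; exact ih i (h.2.2.2.2 i)⟩

theorem mem_points_iff {T : CTree E} (h : T.NestedCovering) {x : E} :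
    x ∈ T.points ↔ x ∈ T.leaves := by
  simp only [points, List.mem_toFinset, List.mem_map]
  constructor
  · rintro ⟨N, hN, rfl⟩
    exact (leaves_sublist hN).subset (pt_mem_leaves (h.of_mem_nodes hN))
  · intro hx
    exact ⟨_, exists_node_of_mem_leaves hx, rfl⟩

theorem exists_child_of_mem_points {p : E} {s : ℤ} {n : ℕ} {ch : Fin n → CTree E}
    (h : (node p s n ch).NestedCovering) {x : E} (hx : x ∈ (node p s n ch).points) :
    ∃ i, x ∈ (ch i).points := by
  rw [mem_points_iff h, leaves, mem_flatten_ofFn] at hx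
  obtain ⟨i, hi⟩ := hx
  exact ⟨i, (mem_points_iff (h.2.2.2.2 i)).2 hi⟩

/-- Geometric series: a child is within `2 ^ s`, and its own radius is at most `2 ^ s` because its
scale is smaller. -/
theorem dist_pt_le_radius {T : CTree E} (h : T.NestedCovering) {x : E} (hx : x ∈ T.points) :
    dist x T.pt ≤ T.radius := by
  induction T with
  | leaf p =>
    rw [mem_points_iff h, leaves, List.mem_singleton] at hx
    simp [hx, pt, radius]
  | node p s n ch ih =>
    obtain ⟨i, hi⟩ := exists_child_of_mem_points h hx
    have h1 := ih i (h.2.2.2.2 i) hi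
    have h2 := radius_le_of_lt (h.2.2.1 i)
    have h3 := h.2.2.2.1 i
    have h4 := dist_triangle x (ch i).pt p
    have h5 : (2 : ℝ) ^ (s + 1) = 2 ^ s * 2 := zpow_add_one₀ two_ne_zero s
    simp only [pt, radius]
    linarith

/-- Every non-leaf branches, so non-leaves are fewer than leaves. This makes node counts linear in
the number of points. -/
theorem size_add_one_le {T : CTree E} (h : T.NestedCovering) :
    T.size + 1 ≤ 2 * T.leaves.length := by
  induction T with
  | leaf p => simp [size, leaves]
  | node p s n ch ih =>
    have h1 : ∑ i, ((ch i).size + 1) ≤ ∑ i, 2 * (ch i).leaves.length :=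
      Finset.sum_le_sum fun i _ => ih i (h.2.2.2.2 i)
    have h2 : (node p s n ch).leaves.length = ∑ i, (ch i).leaves.length := by
      simp [leaves, List.map_ofFn, List.sum_ofFn, Function.comp_def]
    rw [Finset.sum_add_distrib, ← Finset.mul_sum] at h1
    simp only [Finset.sum_const, Finset.card_univ, Fintype.card_fin, smul_eq_mul, mul_one] at h1
    have := h.1
    rw [h2, size]
    omega

/-- In the leveled tree with its unstored chains, an expansion descends one level: children of a
node of scale `m` have scale at most `m - 1`, and all other nodes of level `m` persist. -/
theorem expand_levelNodes {T : CTree E} (h : T.NestedCovering) (m : ℤ) :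
    expand (m : WithBot ℤ) (T.levelNodes m) = T.levelNodes (m - 1) := by
  induction T with
  | leaf p => simp [levelNodes, expand, scale]
  | node p s n ch ih =>
    have hcoe : ((node p s n ch).scale = (m : WithBot ℤ)) ↔ s = m :=
      ⟨fun e => WithBot.coe_injective e, fun e => by rw [e]; rfl⟩
    rcases lt_trichotomy s m with hs | hs | hs
    · rw [levelNodes, levelNodes, if_pos hs.le, if_pos (by omega)]
      simp [expand, hcoe, hs.ne]
    · rw [levelNodes, levelNodes, if_pos hs.le, if_neg (by omega)]
      simp only [expand, List.flatMap_cons, List.flatMap_nil, List.append_nil, hcoe, if_pos hs,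
        children]
      have : (fun i => levelNodes (m - 1) (ch i)) = fun i => [ch i] := by
        funext i
        refine levelNodes_eq_self ?_
        have h1 := h.2.2.1 i
        rw [hs] at h1
        cases hc : (ch i).scale with
        | bot => simp
        | coe t =>
          rw [hc] at h1
          have := WithBot.coe_lt_coe.1 h1
          exact WithBot.coe_le_coe.2 (by omega)
      rw [this]
      clear this hcoe ih h hs
      induction n with
      | zero => simp
      | succ n ih => simp [List.ofFn_succ]; exact ih _
    · rw [levelNodes, levelNodes, if_neg (by omega), if_neg (by omega), expand,
        flatMap_flatten_ofFn]
      congr 2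
      funext i
      exact ih i (h.2.2.2.2 i)

/-- Ancestors of `N` have scale at least that of `N`, so the cut at level `j` passes below `N`. -/
theorem level_sublist {T N : CTree E} (h : T.NestedCovering) (hN : N ∈ T.nodes) {j : ℤ}
    (hj : (j : WithBot ℤ) < N.scale) : (N.level j).Sublist (T.level j) := by
  induction T with
  | leaf p => simp only [nodes, List.mem_singleton] at hN; subst hN; exact .refl _
  | node p s n ch ih =>
    have hs : j < s := WithBot.coe_lt_coe.1 (hj.trans_le (scale_le_of_mem_nodes h hN))
    rcases mem_nodes_node.1 hN with rfl | ⟨i, hi⟩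
    · exact .refl _
    · rw [level, if_neg hs.not_ge]
      exact (ih i (h.2.2.2.2 i) hi).trans (sublist_flatten_ofFn (fun i => (ch i).level j) i)

/-- The children of a node of scale `s` are all present at level `s - 1`. -/
theorem pairwise_dist_children {T : CTree E} {S : Finset E} (h : T.IsCoverTree S) {p : E} {s : ℤ}
    {n : ℕ} {ch : Fin n → CTree E} (hN : node p s n ch ∈ T.nodes) :
    ((node p s n ch).children.map pt).Pairwise fun x y => (2 : ℝ) ^ (s - 1) < dist x y := by
  have h1 := level_sublist (j := s - 1) h.1 hN (WithBot.coe_lt_coe.2 (by omega))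
  refine List.Pairwise.sublist ?_ (h.2.1 (s - 1))
  convert h1 using 1
  rw [← levelNodes_map_pt, ← expand_levelNodes (h.1.of_mem_nodes hN),
    levelNodes_eq_self (T := node p s n ch) (le_of_eq rfl)]
  simp [expand, scale]

theorem IsCoverTree.nodup_leaves {T : CTree E} {S : Finset E} (h : T.IsCoverTree S) :
    T.leaves.Nodup := by
  obtain ⟨j, hj⟩ := exists_forall_lt_scale T
  rw [← level_eq_leaves hj]
  refine (h.2.1 j).imp fun {x y} hxy e => ?_
  rw [e, dist_self] at hxy
  exact absurd hxy (by positivity : (0 : ℝ) < 2 ^ j).not_gt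

theorem IsCoverTree.length_leaves {T : CTree E} {S : Finset E} (h : T.IsCoverTree S) :
    T.leaves.length = S.card := by
  classical
  rw [← List.toFinset_card_of_nodup h.nodup_leaves, ← h.2.2]
  congr 1
  ext x
  rw [mem_points_iff h.1, List.mem_toFinset]

theorem IsCoverTree.size_le {T : CTree E} {S : Finset E} (h : T.IsCoverTree S) :
    T.size ≤ 2 * S.card := by
  have := size_add_one_le h.1
  rw [h.length_leaves] at this
  omega

/-- One level below the smallest non-leaf scale only leaves are present. For a tree that is a single
leaf, `minScale` is the default `sInf ∅` and there is no pair to separate. -/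
theorem IsCoverTree.pairwise_leaves {T : CTree E} {S : Finset E} (h : T.IsCoverTree S) :
    T.leaves.Pairwise fun x y => (2 : ℝ) ^ (T.minScale - 1) < dist x y := by
  rw [← level_eq_leaves (j := T.minScale - 1)]
  · exact h.2.1 _
  · intro N hN s hs
    have := minScale_le hN hs
    omega

/-- The state is indexed by subtrees as values, so equal subtrees at two places would share their
entries. Distinctness of the leaf points excludes this. -/
theorem disjoint_nodes_children {T : CTree E} {S : Finset E} (h : T.IsCoverTree S) {p : E} {s : ℤ}
    {n : ℕ} {ch : Fin n → CTree E} (hN : node p s n ch ∈ T.nodes) {i j : Fin n} (hij : i ≠ j)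
    {N : CTree E} (hi : N ∈ (ch i).nodes) : N ∉ (ch j).nodes := by
  intro hj
  have h1 := h.nodup_leaves.sublist (leaves_sublist hN)
  rw [leaves, List.nodup_flatten] at h1
  have hNC : N.NestedCovering :=
    h.1.of_mem_nodes (mem_nodes_trans (mem_nodes_trans hN (child_mem_nodes i)) hi)
  have h2 := List.pairwise_ofFn.1 h1.2
  have a := (leaves_sublist hi).subset (pt_mem_leaves hNC)
  have b := (leaves_sublist hj).subset (pt_mem_leaves hNC)
  rcases lt_or_gt_of_ne hij with hlt | hlt
  · exact h2 hlt a b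
  · exact h2 hlt b a

theorem imbalanceBelow_nonneg {T : CTree E} (h : T.NestedCovering) (smin : ℤ) :
    0 ≤ T.imbalanceBelow smin := by
  induction T with
  | leaf p => simp [imbalanceBelow]
  | node p s n ch ih =>
    rw [imbalanceBelow]
    refine Finset.sum_nonneg fun i _ => add_nonneg ?_ (ih i (h.2.2.2.2 i))
    have h1 := h.2.2.1 i
    cases hc : ch i with
    | leaf p => simp [nodeImbalance]
    | node p t n ch =>
      rw [hc] at h1
      have : t < s := WithBot.coe_lt_coe.1 h1
      simp only [nodeImbalance]
      omega

end Metric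
end CTree

end

section
-- Ball counts and expansion constants
section Expansion

variable {E : Type} [MetricSpace E]

open scoped Classical in
theorem ballCount_le_of_subset {S S' : Finset E} {p q : E} {r r' : ℝ}
    (h : ∀ x ∈ S, dist p x ≤ r → x ∈ S' ∧ dist q x ≤ r') : ballCount S p r ≤ ballCount S' q r' := by
  refine Finset.card_le_card fun x hx => ?_
  rw [Finset.mem_filter] at hx ⊢
  exact h x hx.1 hx.2

theorem one_le_ballCount {S : Finset E} {p : E} (hp : p ∈ S) {r : ℝ} (hr : 0 ≤ r) :
    1 ≤ ballCount S p r := by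
  classical
  exact Finset.card_pos.2 ⟨p, Finset.mem_filter.2 ⟨hp, by simpa using hr⟩⟩

/-- A ball about a point of `S` counts that point, so `2 + |S|` is admissible and the infimum is
over a nonempty set. -/
theorem expansionConstant_set_nonempty (S : Finset E) :
    {c : ℝ | 2 ≤ c ∧ ∀ p ∈ S, ∀ Δ : ℝ, 0 < Δ →
      (ballCount S p (2 * Δ) : ℝ) ≤ c * (ballCount S p Δ : ℝ)}.Nonempty := by
  classical
  refine ⟨2 + S.card, by simp, fun p hp Δ hΔ => ?_⟩
  have h1 : (1 : ℝ) ≤ ballCount S p Δ := by exact_mod_cast one_le_ballCount hp hΔ.le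
  have h2 : (ballCount S p (2 * Δ) : ℝ) ≤ S.card := by exact_mod_cast Finset.card_filter_le _ _
  have h3 : (0 : ℝ) ≤ S.card := by positivity
  nlinarith

theorem two_le_expansionConstant (S : Finset E) : 2 ≤ expansionConstant S :=
  le_csInf (expansionConstant_set_nonempty S) fun _ h => h.1

theorem ballCount_two_mul_le {S : Finset E} {p : E} (hp : p ∈ S) {r : ℝ} (hr : 0 < r) :
    (ballCount S p (2 * r) : ℝ) ≤ expansionConstant S * ballCount S p r := by
  have h1 : (0 : ℝ) < ballCount S p r := by exact_mod_cast one_le_ballCount hp hr.le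
  rw [← div_le_iff₀ h1]
  refine le_csInf (expansionConstant_set_nonempty S) fun c hc => ?_
  rw [div_le_iff₀ h1]
  exact hc.2 p hp r hr

theorem ballCount_two_pow_mul_le {S : Finset E} {p : E} (hp : p ∈ S) {r : ℝ} (hr : 0 < r) (j : ℕ) :
    (ballCount S p (2 ^ j * r) : ℝ) ≤ expansionConstant S ^ j * ballCount S p r := by
  induction j with
  | zero => simp
  | succ j ih =>
    have h1 := ballCount_two_mul_le hp (r := 2 ^ j * r) (by positivity)
    have h2 := two_le_expansionConstant S
    have e : (2 : ℝ) ^ (j + 1) * r = 2 * (2 ^ j * r) := by ring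
    rw [e, pow_succ']
    calc _ ≤ _ := h1
      _ ≤ expansionConstant S * (expansionConstant S ^ j * ballCount S p r) := by gcongr
      _ = _ := by ring

theorem expansionConstant_le_joint (S C : Finset E) :
    expansionConstant C ≤ jointExpansionConstant S C := le_max_right _ _

open scoped Classical in
theorem expansionConstant_insert_le_joint {S C : Finset E} {q : E} (hq : q ∈ S) :
    expansionConstant (insert q C) ≤ jointExpansionConstant S C := by
  refine le_trans ?_ (le_max_left _ _)
  exact le_ciSup (f := fun q : S => expansionConstant (insert (q : E) C))
    (Set.finite_range _).bddAbove ⟨q, hq⟩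

/-- The number of points of `C` within `2 ^ j * D` of a point `q` at distance more than `D` from
`C`. -/
theorem ballCount_le_joint_pow {S C : Finset E} {q : E} (hq : q ∈ S) {D : ℝ} (hD : 0 < D)
    (hC : ∀ c ∈ C, D < dist q c) (j : ℕ) :
    (ballCount C q (2 ^ j * D) : ℝ) ≤ jointExpansionConstant S C ^ j := by
  classical
  have h1 := ballCount_two_pow_mul_le (S := insert q C) (Finset.mem_insert_self q C) hD j
  -- All of `C` is farther than `D` from `q`, so the doublings start from a ball with one point.
  have h2 : ballCount (insert q C) q D = 1 := by
    refine Finset.card_eq_one.2 ⟨q, ?_⟩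
    ext x
    simp only [Finset.mem_filter, Finset.mem_insert, Finset.mem_singleton]
    constructor
    · rintro ⟨rfl | hx, h⟩
      · rfl
      · exact absurd h (hC x hx).not_ge
    · rintro rfl
      exact ⟨Or.inl rfl, by simpa using hD.le⟩
  have h3 : ballCount C q (2 ^ j * D) ≤ ballCount (insert q C) q (2 ^ j * D) :=
    ballCount_le_of_subset fun x hx h => ⟨Finset.mem_insert_of_mem hx, h⟩
  rw [h2, Nat.cast_one, mul_one] at h1
  calc (ballCount C q (2 ^ j * D) : ℝ) ≤ ballCount (insert q C) q (2 ^ j * D) := by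
        exact_mod_cast h3
    _ ≤ _ := h1
    _ ≤ _ := by
        have := two_le_expansionConstant (insert q C)
        gcongr
        exact expansionConstant_insert_le_joint hq

theorem length_le_ballCount {C : Finset E} {q : E} {r : ℝ} {L : List E} (hL : L.Nodup)
    (h : ∀ x ∈ L, x ∈ C ∧ dist q x ≤ r) : L.length ≤ ballCount C q r := by
  classical
  rw [← List.toFinset_card_of_nodup hL]
  refine Finset.card_le_card fun x hx => ?_
  rw [List.mem_toFinset] at hx
  exact Finset.mem_filter.2 (h x hx)

end Expansion

/-! ### Packing with overlapping balls, independently of the dimension -/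

section Packing

variable {E : Type} [NormedAddCommGroup E] [InnerProductSpace ℝ E]

/-- A closed ball of radius `r` contains at most `9` points that are more than `3 / 2 * r` apart,
whatever the dimension. -/
theorem card_le_nine_of_dist_lt {P : Finset E} {y : E} {r : ℝ} (hr : 0 < r)
    (hP : ∀ p ∈ P, ∀ p' ∈ P, p ≠ p' → 3 / 2 * r < dist p p') (hy : ∀ p ∈ P, dist p y ≤ r) :
    P.card ≤ 9 := by
  classical
  have h0 : (0 : ℝ) ≤ inner ℝ (∑ p ∈ P, (p - y)) (∑ p ∈ P, (p - y)) := real_inner_self_nonneg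
  -- For distinct points, `2⟨u, v⟩ = |u|² + |v|² - |u - v|² ≤ 2r² - 9r²/4`. Summing over all pairs,
  -- the square of the norm of the vector sum is at most `(9n - n²) r² / 8`, which forces `n ≤ 9`.
  have key : ∀ p ∈ P, ∀ p' ∈ P,
      inner ℝ (p - y) (p' - y) ≤ (if p = p' then 9 / 8 * r ^ 2 else 0) - r ^ 2 / 8 := by
    intro p hp p' hp'
    have a := hy p hp
    have a' := hy p' hp'
    rw [dist_eq_norm] at a a'
    have b := pow_le_pow_left₀ (norm_nonneg _) a 2
    have b' := pow_le_pow_left₀ (norm_nonneg _) a' 2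
    split_ifs with h
    · subst h
      rw [real_inner_self_eq_norm_sq]
      linarith
    · have c := hP p hp p' hp' h
      rw [dist_eq_norm] at c
      have c2 := pow_le_pow_left₀ (by positivity) c.le 2
      have e : p - p' = (p - y) - (p' - y) := by abel
      rw [e, norm_sub_sq_real] at c2
      nlinarith
  rw [sum_inner] at h0
  simp only [inner_sum] at h0
  have h1 := h0.trans (Finset.sum_le_sum fun p hp => Finset.sum_le_sum fun p' hp' => key p hp p' hp')
  simp only [Finset.sum_sub_distrib, Finset.sum_ite_eq, Finset.sum_const, nsmul_eq_mul,
    Finset.sum_ite_mem, Finset.inter_self] at h1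
  by_contra! h
  have h2 : (10 : ℝ) ≤ P.card := by exact_mod_cast h
  nlinarith [mul_pos hr hr, mul_nonneg (sub_nonneg.2 h2) (mul_pos hr hr).le,
    mul_pos (by linarith : (0:ℝ) < P.card) (mul_pos hr hr),
    mul_nonneg (sub_nonneg.2 h2) (mul_pos (by linarith : (0:ℝ) < P.card) (mul_pos hr hr)).le]

/-- Double counting over the union `U` of the balls of radius `r` about `P`. Each ball grows to
contain `U` after `j` doublings, so `|U|` is at most the `j`-th power times its count; summed over
`P`, the counts are at most `9|U|`, since a point lies in at most nine balls. -/
theorem card_le_expansionConstant_pow {C P : Finset E} {r : ℝ} (hr : 0 < r) (hPC : P ⊆ C)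
    (hP : ∀ p ∈ P, ∀ p' ∈ P, p ≠ p' → 3 / 2 * r < dist p p') {j : ℕ}
    (hj : ∀ p ∈ P, ∀ p' ∈ P, dist p p' + r ≤ 2 ^ j * r) :
    (P.card : ℝ) ≤ 9 * expansionConstant C ^ j := by
  classical
  rcases P.eq_empty_or_nonempty with rfl | ⟨p₀, hp₀⟩
  · have := two_le_expansionConstant C
    simp only [Finset.card_empty, Nat.cast_zero]; positivity
  set U : Finset E := C.filter fun y => ∃ p ∈ P, dist p y ≤ r with hU
  have hU0 : (0 : ℝ) < U.card := by
    refine Nat.cast_pos.2 (Finset.card_pos.2 ?_)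
    exact ⟨p₀, Finset.mem_filter.2 ⟨hPC hp₀, p₀, hp₀, by simpa using hr.le⟩⟩
  have h1 : ∀ p ∈ P, (U.card : ℝ) ≤ expansionConstant C ^ j * ballCount C p r := by
    intro p hp
    refine le_trans ?_ (ballCount_two_pow_mul_le (hPC hp) hr j)
    have : U.card ≤ ballCount C p (2 ^ j * r) := by
      refine Finset.card_le_card fun y hy => ?_
      obtain ⟨hyC, p', hp', hd⟩ := Finset.mem_filter.1 hy
      refine Finset.mem_filter.2 ⟨hyC, ?_⟩
      have := hj p hp p' hp'
      have := dist_triangle p p' y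
      linarith
    exact_mod_cast this
  have h2 : ∑ p ∈ P, ballCount C p r ≤ 9 * U.card := by
    have e : ∀ p ∈ P, ballCount C p r = ∑ y ∈ U, if dist p y ≤ r then 1 else 0 := by
      intro p hp
      rw [← Finset.card_filter, ballCount]
      congr 1
      ext y
      simp only [hU, Finset.mem_filter]
      exact ⟨fun h => ⟨⟨h.1, p, hp, h.2⟩, h.2⟩, fun h => ⟨h.1.1, h.2⟩⟩
    rw [Finset.sum_congr rfl e, Finset.sum_comm, mul_comm, ← smul_eq_mul, ← Finset.sum_const]
    refine Finset.sum_le_sum fun y _ => ?_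
    rw [← Finset.card_filter]
    refine card_le_nine_of_dist_lt (y := y) hr (fun p hp p' hp' => ?_) fun p hp =>
      (Finset.mem_filter.1 hp).2
    exact hP p (Finset.mem_filter.1 hp).1 p' (Finset.mem_filter.1 hp').1
  have h3 := Finset.sum_le_sum h1
  rw [Finset.sum_const, nsmul_eq_mul, ← Finset.mul_sum] at h3
  have h2' : (∑ p ∈ P, (ballCount C p r : ℝ)) ≤ 9 * U.card := by exact_mod_cast h2
  have h4 : (0 : ℝ) ≤ expansionConstant C ^ j := by
    have := two_le_expansionConstant C
    positivity
  refine le_of_mul_le_mul_right ?_ hU0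
  calc _ ≤ _ := h3
    _ ≤ expansionConstant C ^ j * (9 * U.card) := by gcongr
    _ = _ := by ring

/-- The list form of `card_le_expansionConstant_pow`. -/
theorem length_le_expansionConstant_pow {C : Finset E} {L : List E} {δ r : ℝ} (hr : 0 < r)
    (hδ : 3 / 2 * r ≤ δ) (hLC : ∀ x ∈ L, x ∈ C) (hL : L.Pairwise fun x y => δ < dist x y) {j : ℕ}
    (hj : ∀ p ∈ L, ∀ p' ∈ L, dist p p' + r ≤ 2 ^ j * r) :
    (L.length : ℝ) ≤ 9 * expansionConstant C ^ j := by
  classical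
  have hnd : L.Nodup := hL.imp fun {x y} h e => by
    rw [e, dist_self] at h
    linarith
  rw [← List.toFinset_card_of_nodup hnd]
  refine card_le_expansionConstant_pow hr (fun x hx => hLC x (List.mem_toFinset.1 hx)) ?_ ?_
  · intro p hp p' hp' hne
    rw [List.mem_toFinset] at hp hp'
    have : Std.Symm fun x y : E => δ < dist x y := ⟨fun x y h => by rwa [dist_comm]⟩
    have := hL.forall hp hp' hne
    linarith
  · intro p hp p' hp'
    exact hj p (List.mem_toFinset.1 hp) p' (List.mem_toFinset.1 hp')

end Packing

end

/-! ### How scoring changes the state -/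

section
/-- All centroids but one are pruned for `Nq`. -/
def Done {E : Type} (k : ℕ) (Nq : CTree E) (st : State E) : Prop := (st.pruned Nq).card + 1 = k

section StateLemmas

variable {E : Type}

theorem enter_of_mem {par : Option (CTree E)} {Nq : CTree E} {st : State E}
    (h : Nq ∈ st.visited) : enter par Nq st = st := by
  unfold enter
  rw [if_pos h]

theorem enter_spec (par : Option (CTree E)) (Nq : CTree E) (st : State E) :
    (enter par Nq st).steps = st.steps ∧ (enter par Nq st).ub = st.ub ∧
      (enter par Nq st).visited = insert Nq st.visited ∧
      (∀ N, N ≠ Nq → (enter par Nq st).pruned N = st.pruned N) ∧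
      (∀ P, par = some P → Nq ∉ st.visited → (enter par Nq st).pruned Nq = st.pruned P) ∧
      ((par = none ∨ Nq ∈ st.visited) → (enter par Nq st).pruned Nq = st.pruned Nq) := by
  classical
  unfold enter
  split_ifs with h
  · exact ⟨rfl, rfl, (Set.insert_eq_of_mem h).symm, fun _ _ => rfl, fun _ _ h' => absurd h h',
      fun _ => rfl⟩
  · cases par with
    | none => exact ⟨rfl, rfl, rfl, fun _ _ => rfl, fun _ h' => by simp at h', fun _ => rfl⟩
    | some P =>
      refine ⟨rfl, rfl, rfl, fun N hN => Function.update_of_ne hN (st.pruned P) st.pruned,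
        fun P' h' _ => ?_, ?_⟩
      · cases h'
        exact Function.update_self Nq (st.pruned P) st.pruned
      · rintro (h' | h')
        · simp at h'
        · exact absurd h' h

theorem enter_tick_enter (par : Option (CTree E)) (Nq : CTree E) (t : ℕ) (st : State E) :
    enter par Nq ((enter par Nq st).tick t) = enter par Nq (st.tick t) := by
  have hv : Nq ∈ ((enter par Nq st).tick t).visited := by
    change Nq ∈ (enter par Nq st).visited
    rw [(enter_spec par Nq st).2.2.1]
    exact Set.mem_insert _ _
  rw [enter_of_mem hv]
  unfold enter State.tick
  dsimp only
  split_ifs with h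
  · rfl
  · cases par <;> rfl

variable [MetricSpace E]

/-- Every `ub Nq` is an upper bound on the distances from descendant points to `C`. -/
def UbValid (Tq : CTree E) (C : Finset E) (st : State E) : Prop :=
  ∀ Nq ∈ Tq.nodes, ∀ x ∈ Nq.points, ∃ c ∈ C, ((dist x c : ℝ) : EReal) ≤ st.ub Nq

/-- Every centroid nearest to a descendant point of `Nq` descends from an element of `R`. -/
def Covers (C : Finset E) (Nq : CTree E) (R : List (CTree E)) : Prop :=
  ∀ x ∈ Nq.points, ∀ c ∈ C, (∀ c' ∈ C, dist x c ≤ dist x c') → ∃ Nr ∈ R, c ∈ Nr.points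

/-- What the processing of the subtree `Nq` may change in the state. -/
structure Frame (Tq : CTree E) (C : Finset E) (Nq : CTree E) (st st' : State E) : Prop where
  visited : ∀ N ∈ st'.visited, N ∈ st.visited ∨ N ∈ Nq.nodes
  pruned : ∀ N, N ∉ Nq.nodes → st'.pruned N = st.pruned N
  ubValid : UbValid Tq C st → UbValid Tq C st'

theorem Frame.trans {Tq Nq : CTree E} {C : Finset E} {st st' st'' : State E}
    (h : Frame Tq C Nq st st') (h' : Frame Tq C Nq st' st'') : Frame Tq C Nq st st'' where
  visited N hN := (h'.visited N hN).elim (h.visited N) Or.inr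
  pruned N hN := (h'.pruned N hN).trans (h.pruned N hN)
  ubValid hv := h'.ubValid (h.ubValid hv)

theorem Frame.mono {Tq Nq N' : CTree E} {C : Finset E} {st st' : State E}
    (h : Frame Tq C N' st st') (hN : N' ∈ Nq.nodes) : Frame Tq C Nq st st' where
  visited N h' := (h.visited N h').imp_right (CTree.mem_nodes_trans hN)
  pruned N h' := h.pruned N fun h'' => h' (CTree.mem_nodes_trans hN h'')
  ubValid := h.ubValid

theorem Frame.of_eq {Tq Nq : CTree E} {C : Finset E} {st st' : State E}
    (hv : st'.visited = st.visited) (hp : st'.pruned = st.pruned) (hu : st'.ub = st.ub) :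
    Frame Tq C Nq st st' where
  visited N hN := Or.inl (hv ▸ hN)
  pruned N _ := by rw [hp]
  ubValid h := by unfold UbValid; rw [hu]; exact h

theorem baseCase_spec (p c : E) (st : State E) :
    (baseCase p c st).visited = st.visited ∧ (baseCase p c st).pruned = st.pruned ∧
      (baseCase p c st).ub = st.ub ∧ (baseCase p c st).steps = st.steps + 1 := by
  unfold baseCase
  dsimp only
  by_cases h1 : ((dist p c : ℝ) : EReal) < (st.tick 1).ubPt p
  · rw [if_pos h1]; exact ⟨rfl, rfl, rfl, rfl⟩
  · rw [if_neg h1]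
    by_cases h2 : ((dist p c : ℝ) : EReal) < (st.tick 1).lbPt p
    · rw [if_pos h2]; exact ⟨rfl, rfl, rfl, rfl⟩
    · rw [if_neg h2]; exact ⟨rfl, rfl, rfl, rfl⟩

theorem baseCases_spec (Nq : CTree E) (R : List (CTree E)) (st : State E) :
    (baseCases Nq R st).visited = st.visited ∧ (baseCases Nq R st).pruned = st.pruned ∧
      (baseCases Nq R st).ub = st.ub ∧ (baseCases Nq R st).steps = st.steps + R.length := by
  induction R generalizing st with
  | nil => exact ⟨rfl, rfl, rfl, rfl⟩
  | cons a R ih =>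
    obtain ⟨h1, h2, h3, h4⟩ := ih (baseCase Nq.pt a.pt st)
    obtain ⟨g1, g2, g3, g4⟩ := baseCase_spec Nq.pt a.pt st
    refine ⟨h1.trans g1, h2.trans g2, h3.trans g3, h4.trans ?_⟩
    rw [g4, List.length_cons]
    omega

variable {Tq Tr : CTree E}

/-- Only the first score of a list can meet an unvisited `Nq`. Entering beforehand has the same
effect, so the analysis of scores may assume that `Nq` is visited. -/
theorem scoreAll_enter (A : Implementation Tq Tr) (k : ℕ) (par : Option (CTree E)) (Nq : CTree E)
    {R : List (CTree E)} (hR : R ≠ []) (st : State E) :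
    scoreAll A k par Nq R (enter par Nq st) = scoreAll A k par Nq R st := by
  cases R with
  | nil => exact absurd rfl hR
  | cons a R => simp only [scoreAll, score, enter_tick_enter]

theorem score_spec (A : Implementation Tq Tr) (k : ℕ) (par : Option (CTree E)) {Nq Nr : CTree E}
    (hq : Nq ∈ Tq.nodes) (hr : Nr ∈ Tr.nodes) {st : State E} (hv : Nq ∈ st.visited) :
    (score A k par Nq Nr st).2.steps = st.steps + 1 ∧
    (score A k par Nq Nr st).2.visited = st.visited ∧
    (∀ N, N ≠ Nq → (score A k par Nq Nr st).2.pruned N = st.pruned N) ∧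
    (UbValid Tq Tr.points st → UbValid Tq Tr.points (score A k par Nq Nr st).2) ∧
    (score A k par Nq Nr st).2.ub Nq ≤ st.ub Nq ∧
    (Done k Nq st → (score A k par Nq Nr st).1 = ⊤ ∧ Done k Nq (score A k par Nq Nr st).2) ∧
    ((score A k par Nq Nr st).1 ≠ ⊤ → ((A.dmin Nq Nr : ℝ) : EReal) ≤ st.ub Nq ∧
      (score A k par Nq Nr st).2.ub Nq ≤ ((A.dmax Nq (A.pick Nq Nr) : ℝ) : EReal)) ∧
    ((score A k par Nq Nr st).1 = ⊤ → Done k Nq (score A k par Nq Nr st).2 ∨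
      st.ub Nq < ((A.dmin Nq Nr : ℝ) : EReal)) := by
  classical
  set res := score A k par Nq Nr st with hres
  have hv' : Nq ∈ (st.tick 1).visited := hv
  rw [score, enter_of_mem hv'] at hres
  by_cases hd : Done k Nq st
  · have : ((st.tick 1).pruned Nq).card + 1 = k := hd
    rw [if_pos this] at hres
    rw [hres]
    exact ⟨rfl, rfl, fun _ _ => rfl, fun h => h, le_rfl, fun h => ⟨rfl, h⟩, fun h => absurd rfl h,
      fun _ => Or.inl hd⟩
  · have hd' : ¬ ((st.tick 1).pruned Nq).card + 1 = k := hd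
    rw [if_neg hd'] at hres
    dsimp only at hres
    unfold compareBounds at hres
    dsimp only at hres
    by_cases h1 : (st.tick 1).ub Nq < ((A.dmin Nq Nr : ℝ) : EReal)
    · rw [if_pos h1] at hres
      have hst : res.2 = { (st.tick 1) with
          lb := if ((A.dmin Nq Nr : ℝ) : EReal) < (st.tick 1).lb Nq then
            Function.update (st.tick 1).lb Nq ((A.dmin Nq Nr : ℝ) : EReal) else (st.tick 1).lb
          pruned := Function.update (st.tick 1).pruned Nq
            ((st.tick 1).pruned Nq ∪ Nr.points) } := by
        rw [hres]; split_ifs <;> rfl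
      have htop : res.1 = ⊤ := by rw [hres]; split_ifs <;> rfl
      refine ⟨by rw [hst]; rfl, by rw [hst]; rfl, fun N hN => ?_, fun h => ?_, ?_,
        fun h => absurd h hd, fun h => absurd htop h, fun _ => Or.inr h1⟩
      · rw [hst]; exact Function.update_of_ne hN _ _
      · rw [hst]; exact h
      · rw [hst]; exact le_rfl
    · rw [if_neg h1] at hres
      by_cases h2 : ((A.dmax Nq (A.pick Nq Nr) : ℝ) : EReal) < (st.tick 1).ub Nq
      · rw [if_pos h2, if_neg hd'] at hres
        rw [hres]
        refine ⟨rfl, rfl, fun _ _ => rfl, fun h N hN x hx => ?_, ?_, fun h => absurd h hd,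
          fun _ => ⟨not_lt.1 h1, ?_⟩, fun h => absurd h (EReal.coe_ne_top _)⟩
        · by_cases hNq : N = Nq
          · subst hNq
            dsimp only
            rw [Function.update_self]
            have hp := CTree.points_subset hr (A.pick_mem _ hq _ hr)
            exact ⟨_, hp, EReal.coe_le_coe_iff.2 (A.le_dmax _ hq _ hp x hx)⟩
          · dsimp only
            rw [Function.update_of_ne hNq]
            exact h N hN x hx
        · dsimp only
          rw [Function.update_self]
          exact h2.le
        · dsimp only
          rw [Function.update_self]
      · rw [if_neg h2, if_neg hd'] at hres
        rw [hres]
        exact ⟨rfl, rfl, fun _ _ => rfl, fun h => h, le_rfl, fun h => absurd h hd,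
          fun _ => ⟨not_lt.1 h1, not_lt.1 h2⟩, fun h => absurd h (EReal.coe_ne_top _)⟩

/-- Coverage persists: if the distance test dropped a node holding a centroid nearest to some
descendant point, `ub` would be below that nearest distance and not be valid. The other reason for
dropping, `Done`, is permanent within the list. -/
theorem scoreAll_spec (A : Implementation Tq Tr) (k : ℕ) (par : Option (CTree E)) {Nq : CTree E}
    (hq : Nq ∈ Tq.nodes) {R : List (CTree E)} (hr : ∀ Nr ∈ R, Nr ∈ Tr.nodes) {st : State E}
    (hv : Nq ∈ st.visited) :
    (scoreAll A k par Nq R st).2.steps = st.steps + R.length ∧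
    (scoreAll A k par Nq R st).2.visited = st.visited ∧
    (∀ N, N ≠ Nq → (scoreAll A k par Nq R st).2.pruned N = st.pruned N) ∧
    (UbValid Tq Tr.points st → UbValid Tq Tr.points (scoreAll A k par Nq R st).2) ∧
    (scoreAll A k par Nq R st).2.ub Nq ≤ st.ub Nq ∧
    (Done k Nq st →
      (scoreAll A k par Nq R st).1 = [] ∧ Done k Nq (scoreAll A k par Nq R st).2) ∧
    (∀ Nr ∈ (scoreAll A k par Nq R st).1, ((A.dmin Nq Nr : ℝ) : EReal) ≤ st.ub Nq ∧
      (scoreAll A k par Nq R st).2.ub Nq ≤ ((A.dmax Nq (A.pick Nq Nr) : ℝ) : EReal)) ∧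
    (UbValid Tq Tr.points st → Covers Tr.points Nq R →
      Done k Nq (scoreAll A k par Nq R st).2 ∨
        Covers Tr.points Nq (scoreAll A k par Nq R st).1) := by
  -- The induction tracks survival node by node, since the tail of a covering list need not cover.
  have main : ∀ st : State E, Nq ∈ st.visited →
      (scoreAll A k par Nq R st).2.steps = st.steps + R.length ∧
      (scoreAll A k par Nq R st).2.visited = st.visited ∧
      (∀ N, N ≠ Nq → (scoreAll A k par Nq R st).2.pruned N = st.pruned N) ∧
      (UbValid Tq Tr.points st → UbValid Tq Tr.points (scoreAll A k par Nq R st).2) ∧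
      (scoreAll A k par Nq R st).2.ub Nq ≤ st.ub Nq ∧
      (Done k Nq st →
        (scoreAll A k par Nq R st).1 = [] ∧ Done k Nq (scoreAll A k par Nq R st).2) ∧
      (∀ Nr ∈ (scoreAll A k par Nq R st).1, ((A.dmin Nq Nr : ℝ) : EReal) ≤ st.ub Nq ∧
        (scoreAll A k par Nq R st).2.ub Nq ≤ ((A.dmax Nq (A.pick Nq Nr) : ℝ) : EReal)) ∧
      (UbValid Tq Tr.points st → Done k Nq (scoreAll A k par Nq R st).2 ∨
        ∀ Nr ∈ R, ∀ x ∈ Nq.points, ∀ c ∈ Nr.points, (∀ c' ∈ Tr.points, dist x c ≤ dist x c') →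
          Nr ∈ (scoreAll A k par Nq R st).1) := by
    induction R with
    | nil =>
      intro st hv
      exact ⟨rfl, rfl, fun _ _ => rfl, fun h => h, le_rfl, fun h => ⟨rfl, h⟩,
        fun _ h => by simp [scoreAll] at h, fun _ => Or.inr fun _ h => by simp at h⟩
    | cons a R ih =>
      intro st hv
      obtain ⟨s1, s2, s3, s4, s5, s6, s7, s8⟩ := score_spec A k par hq (hr a (by simp)) hv
      simp only [scoreAll]
      set res := score A k par Nq a st
      obtain ⟨t1, t2, t3, t4, t5, t6, t7, t8⟩ :=
        ih (fun Nr h => hr Nr (by simp [h])) res.2 (s2 ▸ hv)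
      set rest := scoreAll A k par Nq R res.2
      refine ⟨?_, t2.trans s2, fun N hN => (t3 N hN).trans (s3 N hN), fun h => t4 (s4 h),
        t5.trans s5, fun h => ?_, fun Nr h => ?_, fun h => ?_⟩
      · rw [t1, s1, List.length_cons]; omega
      · obtain ⟨a1, a2⟩ := s6 h
        rw [if_pos a1]
        exact t6 a2
      · have hrest : Nr ∈ rest.1 → ((A.dmin Nq Nr : ℝ) : EReal) ≤ st.ub Nq ∧
            rest.2.ub Nq ≤ ((A.dmax Nq (A.pick Nq Nr) : ℝ) : EReal) :=
          fun h' => ⟨(t7 Nr h').1.trans s5, (t7 Nr h').2⟩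
        split_ifs at h with htop
        · exact hrest h
        · rcases List.mem_cons.1 h with rfl | h
          · exact ⟨(s7 htop).1, t5.trans (s7 htop).2⟩
          · exact hrest h
      · by_cases hdone : Done k Nq rest.2
        · exact Or.inl hdone
        · refine Or.inr fun Nr hNr x hx c hc hmin => ?_
          rcases List.mem_cons.1 hNr with rfl | hNr
          · have : res.1 ≠ ⊤ := fun htop => by
              rcases s8 htop with h' | h'
              · exact hdone (t6 h').2
              · obtain ⟨c', hc', hle⟩ := h Nq hq x hx
                have h1 := A.dmin_le Nq hq Nr (hr Nr (by simp)) x hx c hc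
                have h2 := EReal.coe_le_coe_iff.2 (h1.trans (hmin c' hc'))
                exact absurd (h'.trans_le (h2.trans hle)) (lt_irrefl _)
            rw [if_neg this]
            exact List.mem_cons_self
          · have := (t8 (s4 h)).resolve_left hdone Nr hNr x hx c hc hmin
            split_ifs
            · exact this
            · exact List.mem_cons_of_mem _ this
  obtain ⟨t1, t2, t3, t4, t5, t6, t7, t8⟩ := main st hv
  refine ⟨t1, t2, t3, t4, t5, t6, t7, fun h hc => (t8 h).imp_right fun h' x hx c hcC hmin => ?_⟩
  obtain ⟨Nr, hNr, hcr⟩ := hc x hx c hcC hmin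
  exact ⟨Nr, h' Nr hNr x hx c hcr hmin, hcr⟩

end StateLemmas

end

section
-- Lists of reference nodes as parts of a level
section ReferenceLists

variable {E : Type}

theorem scale_le_maxScale {R : List (CTree E)} {N : CTree E} (h : N ∈ R) :
    N.scale ≤ maxScale R := by
  induction R with
  | nil => simp at h
  | cons a L ih =>
    have e : maxScale (a :: L) = max a.scale (maxScale L) := rfl
    rw [e]
    rcases List.mem_cons.1 h with rfl | h
    · exact le_max_left _ _
    · exact (ih h).trans (le_max_right _ _)

theorem maxScale_le {R : List (CTree E)} {m : WithBot ℤ} (h : ∀ N ∈ R, N.scale ≤ m) :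
    maxScale R ≤ m := by
  induction R with
  | nil => exact bot_le
  | cons a L ih =>
    exact max_le (h a (by simp)) (ih fun N hN => h N (by simp [hN]))

/-- `R` consists of nodes present at one level of `T`. -/
def AtLevel (T : CTree E) (R : List (CTree E)) : Prop := ∃ j : ℤ, R.Subperm (T.levelNodes j)

theorem AtLevel.sublist {T : CTree E} {R R' : List (CTree E)} (h : AtLevel T R)
    (h' : R'.Sublist R) : AtLevel T R' :=
  h.imp fun _ hj => h'.subperm.trans hj

theorem AtLevel.perm {T : CTree E} {R R' : List (CTree E)} (h : AtLevel T R)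
    (h' : R'.Perm R) : AtLevel T R' :=
  h.imp fun _ hj => h'.subperm.trans hj

theorem AtLevel.mem_nodes {T : CTree E} {R : List (CTree E)} (h : AtLevel T R) :
    ∀ N ∈ R, N ∈ T.nodes := by
  obtain ⟨j, hj⟩ := h
  exact fun N hN => CTree.levelNodes_subset_nodes j T N (hj.subset hN)

theorem subperm_expand {R L : List (CTree E)} (h : R.Subperm L) (m : WithBot ℤ) :
    (expand m R).Subperm (expand m L) := by
  obtain ⟨l, hl, hs⟩ := h
  exact (hl.symm.flatMap_right _).subperm.trans (hs.flatMap _).subperm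

theorem AtLevel.subperm_levelNodes {T : CTree E} {R : List (CTree E)} (h : AtLevel T R) {m : ℤ}
    (hm : maxScale R = (m : WithBot ℤ)) : R.Subperm (T.levelNodes m) := by
  classical
  obtain ⟨j, hj⟩ := h
  have hmj : m ≤ j := by
    refine WithBot.coe_le_coe.1 ?_
    rw [← hm]
    exact maxScale_le fun N hN => CTree.scale_le_of_mem_levelNodes j T N (hj.subset hN)
  have h1 := hj.filter fun N => N.scale ≤ (m : WithBot ℤ)
  rw [List.filter_eq_self.2] at h1
  · exact h1.trans (CTree.filter_levelNodes_sublist hmj T).subperm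
  · intro N hN
    simpa [← hm] using scale_le_maxScale hN

theorem AtLevel.subperm_expand [MetricSpace E] {T : CTree E} (hT : T.NestedCovering)
    {R : List (CTree E)} (h : AtLevel T R) {m : ℤ} (hm : maxScale R = (m : WithBot ℤ)) :
    (expand (m : WithBot ℤ) R).Subperm (T.levelNodes (m - 1)) := by
  rw [← CTree.expand_levelNodes hT]
  exact DualTreeKMeans.subperm_expand (h.subperm_levelNodes hm) _

theorem length_le_totalSize (R : List (CTree E)) : R.length ≤ totalSize R := by
  have := List.length_le_sum_of_one_le (R.map CTree.size) fun i hi => by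
    obtain ⟨N, _, rfl⟩ := List.mem_map.1 hi
    exact N.one_le_size
  simpa [totalSize] using this

theorem totalSize_le_of_sublist {R R' : List (CTree E)} (h : R'.Sublist R) :
    totalSize R' ≤ totalSize R :=
  (h.map CTree.size).sum_le_sum fun _ _ => Nat.zero_le _

theorem AtLevel.subperm_leaves {T : CTree E} {R : List (CTree E)} (h : AtLevel T R) :
    (R.flatMap CTree.leaves).Subperm T.leaves := by
  obtain ⟨j, l, hl, hs⟩ := h
  rw [← CTree.flatMap_leaves_levelNodes j T]
  exact (hl.symm.flatMap_right _).subperm.trans (hs.flatMap _).subperm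

variable [MetricSpace E]

theorem totalSize_le_leaves {T : CTree E} (hT : T.NestedCovering) {R : List (CTree E)}
    (h : ∀ N ∈ R, N ∈ T.nodes) : totalSize R ≤ 2 * (R.flatMap CTree.leaves).length := by
  induction R with
  | nil => simp [totalSize]
  | cons a R ih =>
    have h1 := CTree.size_add_one_le (hT.of_mem_nodes (h a (by simp)))
    have h2 := ih fun N hN => h N (by simp [hN])
    simp only [totalSize, List.map_cons, List.sum_cons, List.flatMap_cons, List.length_append] at *
    omega

theorem pairwise_pt_of_subperm {T : CTree E} {C : Finset E} (hT : T.IsCoverTree C)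
    {R : List (CTree E)} {j : ℤ} (h : R.Subperm (T.levelNodes j)) :
    (R.map CTree.pt).Pairwise fun x y => (2 : ℝ) ^ j < dist x y := by
  have h1 : (R.map CTree.pt).Subperm (T.level j) := by
    rw [← CTree.levelNodes_map_pt]
    obtain ⟨l, hl, hs⟩ := h
    exact ⟨_, hl.map _, hs.map _⟩
  obtain ⟨l, hl, hs⟩ := h1
  exact ((hT.2.1 j).sublist hs).perm hl fun {x y} h => by rwa [dist_comm]

theorem Covers.expand {T Nq : CTree E} (hT : T.NestedCovering) {C : Finset E} {R : List (CTree E)}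
    (hR : ∀ N ∈ R, N ∈ T.nodes) (h : Covers C Nq R) (m : ℤ) :
    Covers C Nq (expand (m : WithBot ℤ) R) := by
  intro x hx c hc hmin
  obtain ⟨Nr, hNr, hcr⟩ := h x hx c hc hmin
  unfold DualTreeKMeans.expand
  simp only [List.mem_flatMap]
  by_cases hs : Nr.scale = (m : WithBot ℤ)
  · cases Nr with
    | leaf p => simp [CTree.scale] at hs
    | node p s n ch =>
      obtain ⟨i, hi⟩ := CTree.exists_child_of_mem_points (hT.of_mem_nodes (hR _ hNr)) hcr
      exact ⟨ch i, ⟨_, hNr, by rw [if_pos hs]; simp [CTree.children, List.mem_ofFn]⟩, hi⟩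
  · exact ⟨Nr, ⟨Nr, hNr, by rw [if_neg hs]; simp⟩, hcr⟩

theorem Covers.of_perm {Nq : CTree E} {C : Finset E} {R R' : List (CTree E)}
    (h : Covers C Nq R) (hp : R'.Perm R) : Covers C Nq R' := by
  intro x hx c hc hmin
  obtain ⟨Nr, hNr, hcr⟩ := h x hx c hc hmin
  exact ⟨Nr, hp.mem_iff.2 hNr, hcr⟩

theorem Covers.of_mem {Nq N : CTree E} {C : Finset E} {R : List (CTree E)}
    (h : Covers C Nq R) (hN : N ∈ Nq.nodes) : Covers C N R :=
  fun x hx c hc hmin => h x (CTree.points_subset hN hx) c hc hmin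

end ReferenceLists

/-! ### Unfolding the recursion -/

section Traverse

variable {E : Type} [MetricSpace E] {Tq Tr : CTree E}

theorem traverse_of_lt (A : Implementation Tq Tr) (k : ℕ) (par : Option (CTree E)) {Nq : CTree E}
    {R : List (CTree E)} (h : Nq.scale < maxScale R) (st : State E) :
    traverse A k par Nq R st =
      traverse A k par Nq
        (scoreAll A k par Nq (A.order Nq (expand (maxScale R) R))
          (baseCases Nq R (st.tick (1 + 2 * R.length)))).1
        (scoreAll A k par Nq (A.order Nq (expand (maxScale R) R))
          (baseCases Nq R (st.tick (1 + 2 * R.length)))).2 := by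
  rw [traverse, dif_pos h]

theorem traverse_leaf (A : Implementation Tq Tr) (k : ℕ) (par : Option (CTree E)) {p : E}
    {R : List (CTree E)} (h : ¬ (CTree.leaf p).scale < maxScale R) (st : State E) :
    traverse A k par (.leaf p) R st = baseCases (.leaf p) R (st.tick (1 + 2 * R.length)) := by
  rw [traverse, dif_neg h]
  split_ifs <;> rfl

theorem traverse_nil (A : Implementation Tq Tr) (k : ℕ) (par : Option (CTree E)) (Nq : CTree E)
    (st : State E) : traverse A k par Nq [] st = st.tick 1 := by
  rw [traverse, dif_neg (by simp [maxScale])]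
  rw [if_pos rfl]
  rfl

theorem traverse_node (A : Implementation Tq Tr) (k : ℕ) (par : Option (CTree E)) {p : E} {s : ℤ}
    {n : ℕ} {ch : Fin n → CTree E} {R : List (CTree E)} (hR : R ≠ [])
    (h : ¬ (CTree.node p s n ch).scale < maxScale R) (st : State E) :
    traverse A k par (.node p s n ch) R st =
      (List.finRange n).foldl (fun st i =>
        traverse A k (some (.node p s n ch)) (ch i)
          (scoreAll A k (some (.node p s n ch)) (ch i) (A.order (ch i) R) st).1
          (scoreAll A k (some (.node p s n ch)) (ch i) (A.order (ch i) R) st).2)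
        (baseCases (.node p s n ch) R (st.tick (1 + 2 * R.length))) := by
  rw [traverse, dif_neg h, if_neg hR]

end Traverse

end

/-! ### The invariant and the size of the reference list -/

section
section

variable {E : Type} [MetricSpace E] {Tq Tr : CTree E}

/-- The bound on the number of reference nodes in a call of `traverse`. -/
noncomputable def refBound (S C : Finset E) : ℝ :=
  9 * expansionConstant C ^ 6 + jointExpansionConstant S C ^ 3

theorem one_le_refBound (S C : Finset E) : 1 ≤ refBound S C := by
  have h1 := two_le_expansionConstant C
  have h2 := expansionConstant_le_joint S C
  have h3 : (1 : ℝ) ≤ expansionConstant C ^ 6 := one_le_pow₀ (by linarith)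
  have h4 : (1 : ℝ) ≤ jointExpansionConstant S C ^ 3 := one_le_pow₀ (by linarith)
  unfold refBound
  linarith

/-- Far from the centroids, few of them descend from the remaining reference nodes. -/
theorem totalSize_le_joint {S C : Finset E} (hTr : Tr.IsCoverTree C) {q : E} (hq : q ∈ S) {c₀ : E}
    (hmin : ∀ c ∈ C, dist q c₀ ≤ dist q c) {M : ℤ} {R : List (CTree E)}
    (hR : AtLevel Tr R) (hM : maxScale R < (M : WithBot ℤ))
    (hd : ∀ N ∈ R, dist q N.pt ≤ dist q c₀ + 7 * 2 ^ M) (hD : 8 * 2 ^ M ≤ dist q c₀) :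
    (totalSize R : ℝ) ≤ 2 * jointExpansionConstant S C ^ 2 := by
  have hs : (0 : ℝ) < 2 ^ M := by positivity
  obtain ⟨l, hl, hs'⟩ := hR.subperm_leaves
  have hnd : (R.flatMap CTree.leaves).Nodup := hl.nodup_iff.1 (hTr.nodup_leaves.sublist hs')
  have h1 := totalSize_le_leaves hTr.1 hR.mem_nodes
  -- A descendant point is within `2 ^ M` of its node's point, hence within `D + 8 * 2 ^ M ≤ 2 * D`
  -- of `q`, with `D = dist q c₀`. That is two doublings of the radius `D / 2`, within which there
  -- is no centroid.
  have h2 := length_le_ballCount (C := C) (q := q) (r := 2 ^ 2 * (dist q c₀ / 2)) hnd fun x hx => by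
    obtain ⟨N, hN, hxN⟩ := List.mem_flatMap.1 hx
    have hNT := hR.mem_nodes N hN
    have hNC := hTr.1.of_mem_nodes hNT
    rw [← CTree.mem_points_iff hNC] at hxN
    refine ⟨by rw [← hTr.2.2]; exact CTree.points_subset hNT hxN, ?_⟩
    have a := CTree.dist_pt_le_radius hNC hxN
    have b := CTree.radius_le_of_lt ((scale_le_maxScale hN).trans_lt hM)
    have c := hd N hN
    have := dist_triangle_right q x N.pt
    linarith
  have h3 := ballCount_le_joint_pow (C := C) hq (D := dist q c₀ / 2) (by linarith)
    (fun c hc => lt_of_lt_of_le (by linarith) (hmin c hc)) 2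
  have h4 : (totalSize R : ℝ) ≤ 2 * ballCount C q (2 ^ 2 * (dist q c₀ / 2)) := by
    exact_mod_cast h1.trans (Nat.mul_le_mul_left 2 h2)
  linarith

theorem exists_nearest (Tr : CTree E) (q : E) :
    ∃ c₀ ∈ Tr.points, ∀ c ∈ Tr.points, dist q c₀ ≤ dist q c :=
  Finset.exists_min_image _ _ ⟨_, Tr.pt_mem_points⟩

/-- The invariant of the calls of `traverse`. -/
structure Inv (A : Implementation Tq Tr) (k : ℕ) (Nq : CTree E) (R : List (CTree E))
    (st : State E) : Prop where
  mem : Nq ∈ Tq.nodes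
  atLevel : AtLevel Tr R
  length_le : (R.length : ℝ) ≤ refBound Tq.points Tr.points
  visited : R ≠ [] → Nq ∈ st.visited
  ubValid : UbValid Tq Tr.points st
  ub_le : ∀ Nr ∈ R, st.ub Nq ≤ ((A.dmax Nq (A.pick Nq Nr) : ℝ) : EReal)
  covers : Done k Nq st ∨ Covers Tr.points Nq R
  fresh : ∀ N ∈ Nq.nodes, N ≠ Nq → N ∉ st.visited

end

variable {E : Type} [NormedAddCommGroup E] [InnerProductSpace ℝ E] {Tq Tr : CTree E}

theorem length_children_le {C : Finset E} (hTr : Tr.IsCoverTree C) {N : CTree E}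
    (hN : N ∈ Tr.nodes) : (N.children.length : ℝ) ≤ 9 * expansionConstant C ^ 3 := by
  cases N with
  | leaf p =>
    have h1 := two_le_expansionConstant C
    simp only [CTree.children, List.length_nil, Nat.cast_zero]
    positivity
  | node p s n ch =>
    have hs : (0 : ℝ) < 2 ^ s := by positivity
    have e : (2 : ℝ) ^ (s - 1) = 2 ^ s / 2 := zpow_sub_one₀ two_ne_zero s
    have hcov := (hTr.1.of_mem_nodes hN).2.2.2.1
    have hmem : ∀ x ∈ (CTree.node p s n ch).children.map CTree.pt, ∃ i, x = (ch i).pt := by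
      intro x hx
      simp only [CTree.children, List.mem_map, List.mem_ofFn] at hx
      obtain ⟨_, ⟨i, rfl⟩, rfl⟩ := hx
      exact ⟨i, rfl⟩
    rw [← List.length_map (f := CTree.pt)]
    -- With this `r` the separation `2 ^ (s - 1)` is `3 / 2 * r`, and children are at most `2 * 2 ^
    -- s = 6 * r` apart; `6 + 1 ≤ 2 ^ 3`.
    refine length_le_expansionConstant_pow (r := 2 ^ s / 3) (by positivity) ?_ ?_
      (CTree.pairwise_dist_children hTr hN) ?_
    · rw [e]; linarith
    · intro x hx
      obtain ⟨i, rfl⟩ := hmem x hx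
      rw [← hTr.2.2]
      exact CTree.points_subset (CTree.mem_nodes_trans hN (CTree.child_mem_nodes i))
        (CTree.pt_mem_points _)
    · intro x hx y hy
      obtain ⟨i, rfl⟩ := hmem x hx
      obtain ⟨j, rfl⟩ := hmem y hy
      have h1 := hcov i
      have h2 := hcov j
      have h3 := dist_triangle_right (ch i).pt (ch j).pt p
      linarith

theorem length_expand_le {C : Finset E} (hTr : Tr.IsCoverTree C) (m : WithBot ℤ)
    {R : List (CTree E)} (hR : ∀ N ∈ R, N ∈ Tr.nodes) :
    ((expand m R).length : ℝ) ≤ 9 * expansionConstant C ^ 3 * R.length := by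
  have h1 := two_le_expansionConstant C
  have h3 : (1 : ℝ) ≤ expansionConstant C ^ 3 := one_le_pow₀ (by linarith)
  induction R with
  | nil => simp [expand]
  | cons a R ih =>
    have e : (expand m (a :: R)).length =
        (if a.scale = m then a.children else [a]).length + (expand m R).length := by
      unfold expand
      rw [List.flatMap_cons, List.length_append]
    have h2 := ih fun N hN => hR N (by simp [hN])
    have h4 : ((if a.scale = m then a.children else [a]).length : ℝ) ≤
        9 * expansionConstant C ^ 3 := by
      split_ifs
      · exact length_children_le hTr (hR a (by simp))
      · simp only [List.length_singleton, Nat.cast_one]; linarith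
    rw [e, List.length_cons]
    push_cast
    linarith

/-- The size of a list of reference nodes that are close to a query point. -/
theorem length_le_refBound {S C : Finset E} (hTr : Tr.IsCoverTree C) {q : E} (hq : q ∈ S) {c₀ : E}
    (hmin : ∀ c ∈ C, dist q c₀ ≤ dist q c) {M : ℤ} {R : List (CTree E)}
    (hR : R.Subperm (Tr.levelNodes (M - 1)))
    (hd : ∀ N ∈ R, dist q N.pt ≤ dist q c₀ + 7 * 2 ^ M) : (R.length : ℝ) ≤ refBound S C := by
  have hs : (0 : ℝ) < 2 ^ M := by positivity
  have e : (2 : ℝ) ^ (M - 1) = 2 ^ M / 2 := zpow_sub_one₀ two_ne_zero M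
  have hpw := pairwise_pt_of_subperm hTr hR
  have hmem : ∀ x ∈ R.map CTree.pt, x ∈ C ∧ dist q x ≤ dist q c₀ + 7 * 2 ^ M := by
    intro x hx
    obtain ⟨N, hN, rfl⟩ := List.mem_map.1 hx
    refine ⟨?_, hd N hN⟩
    rw [← hTr.2.2]
    exact CTree.points_subset (AtLevel.mem_nodes ⟨_, hR⟩ N hN) (CTree.pt_mem_points _)
  have h1 := two_le_expansionConstant C
  have h2 := expansionConstant_le_joint S C
  have h3 : (0 : ℝ) ≤ expansionConstant C ^ 6 := by positivity
  have h4 : (0 : ℝ) ≤ jointExpansionConstant S C ^ 3 := pow_nonneg (by linarith) _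
  rw [← List.length_map (f := CTree.pt), refBound]
  -- Here `dist q c₀ + 7 * 2 ^ M ≤ 10 / 3 * dist q c₀`, within three doublings of half that
  -- distance. In the other case two points are less than `20 * 2 ^ M = 60 * r` apart for `r = 2 ^ M
  -- / 3`, and `60 + 1 ≤ 2 ^ 6`.
  by_cases hD : 3 * 2 ^ M ≤ dist q c₀
  · have hnd : (R.map CTree.pt).Nodup := hpw.imp fun {x y} h e' => by
      rw [e', dist_self, e] at h
      linarith
    have h5 := length_le_ballCount (C := C) (q := q) (r := 2 ^ 3 * (dist q c₀ / 2)) hnd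
      fun x hx => ⟨(hmem x hx).1, (hmem x hx).2.trans (by linarith)⟩
    have h6 := ballCount_le_joint_pow (C := C) hq (D := dist q c₀ / 2) (by linarith)
      (fun c hc => lt_of_lt_of_le (by linarith) (hmin c hc)) 3
    have h7 : ((R.map CTree.pt).length : ℝ) ≤ ballCount C q (2 ^ 3 * (dist q c₀ / 2)) := by
      exact_mod_cast h5
    linarith
  · have h5 := length_le_expansionConstant_pow (C := C) (r := 2 ^ M / 3) (by positivity)
      (by rw [e]; linarith) (fun x hx => (hmem x hx).1) hpw (j := 6) fun x hx y hy => by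
        have a := (hmem x hx).2
        have b := (hmem y hy).2
        have := dist_triangle_left x y q
        linarith
    linarith

/-- A reference recursion. -/
theorem traverse_step (A : Implementation Tq Tr) (k : ℕ)
    (hTr : Tr.IsCoverTree Tr.points) {Nq : CTree E} {R : List (CTree E)} {st : State E}
    (inv : Inv A k Nq R st) (h : Nq.scale < maxScale R) (par : Option (CTree E)) :
    ∃ (M : ℤ) (R' : List (CTree E)) (st' : State E), maxScale R = (M : WithBot ℤ) ∧
      traverse A k par Nq R st = traverse A k par Nq R' st' ∧ Inv A k Nq R' st' ∧
      Frame Tq Tr.points Nq st st' ∧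
      st'.steps = st.steps + (1 + 3 * R.length + (expand (maxScale R) R).length) ∧
      maxScale R' < (M : WithBot ℤ) ∧ totalSize R' < totalSize R ∧
      ∃ c₀ ∈ Tr.points, (∀ c ∈ Tr.points, dist Nq.pt c₀ ≤ dist Nq.pt c) ∧
        ∀ N ∈ R', dist Nq.pt N.pt ≤ dist Nq.pt c₀ + 7 * 2 ^ M := by
  obtain ⟨M, hM⟩ : ∃ M : ℤ, maxScale R = (M : WithBot ℤ) :=
    ⟨_, (WithBot.coe_unbot _ (bot_le.trans_lt h).ne').symm⟩
  have hR0 : R ≠ [] := by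
    rintro rfl
    simp [maxScale] at h
  have hsub := AtLevel.subperm_expand hTr.1 inv.atLevel hM
  set X := A.order Nq (expand (maxScale R) R) with hX
  have hXp : X.Perm (expand (maxScale R) R) := A.order_perm _ _
  have hXsub : X.Subperm (Tr.levelNodes (M - 1)) := by
    rw [hM] at hXp
    exact hXp.subperm.trans hsub
  obtain ⟨b1, b2, b3, b4⟩ := baseCases_spec Nq R (st.tick (1 + 2 * R.length))
  set st₁ := baseCases Nq R (st.tick (1 + 2 * R.length)) with hst₁
  have hv : Nq ∈ st₁.visited := by rw [b1]; exact inv.visited hR0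
  obtain ⟨t1, t2, t3, t4, t5, t6, t7, t8⟩ := scoreAll_spec A k par inv.mem
    (AtLevel.mem_nodes ⟨_, hXsub⟩) hv
  have htr := traverse_of_lt A k par h st
  have hsl := scoreAll_sublist A k par Nq X st₁
  have htot := totalSize_scoreAll_order_le A k par Nq (expand (maxScale R) R) st₁
  rw [← hX] at htr htot
  rw [← hst₁] at htr
  set R' := (scoreAll A k par Nq X st₁).1
  set st' := (scoreAll A k par Nq X st₁).2
  have hval : UbValid Tq Tr.points st₁ := by
    unfold UbValid; rw [b3]; exact inv.ubValid
  have hR'sub : R'.Subperm (Tr.levelNodes (M - 1)) := hsl.subperm.trans hXsub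
  have hmax : maxScale R' < (M : WithBot ℤ) := by
    refine lt_of_le_of_lt (maxScale_le fun N hN =>
      CTree.scale_le_of_mem_levelNodes _ _ N (hR'sub.subset hN)) (WithBot.coe_lt_coe.2 ?_)
    omega
  obtain ⟨c₀, hc₀, hmin⟩ := exists_nearest Tr Nq.pt
  -- The 7 is the sum of 4 for the distance from `c₀` to the picked centroid (twice the radius `2 ^
  -- (M + 1)` of the node holding both), 2 for the radius of `Nq` in `dmax` and in `dmin`, and 1 for
  -- the radius of `N`. If all centroids but one are already pruned, there is no survivor.
  have hdist : ∀ N ∈ R', dist Nq.pt N.pt ≤ dist Nq.pt c₀ + 7 * 2 ^ M := by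
    intro N hN
    rcases inv.covers with hdone | hcov
    · have : Done k Nq st₁ := by unfold Done; rw [b2]; exact hdone
      rw [(t6 this).1] at hN
      simp at hN
    · obtain ⟨Nr, hNr, hcr⟩ := hcov _ Nq.pt_mem_points c₀ hc₀ hmin
      have hNrT := inv.atLevel.mem_nodes Nr hNr
      have hpick := A.pick_mem Nq inv.mem Nr hNrT
      have hNT := AtLevel.mem_nodes ⟨_, hR'sub⟩ N hN
      have h1 : A.dmin Nq N ≤ A.dmax Nq (A.pick Nq Nr) := by
        refine EReal.coe_le_coe_iff.1 ((t7 N hN).1.trans ?_)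
        rw [b3]
        exact inv.ub_le Nr hNr
      have h2 := A.le_dmin Nq inv.mem N hNT
      have h3 := A.dmax_le Nq inv.mem _ (CTree.points_subset hNrT hpick)
      have hNrC := hTr.1.of_mem_nodes hNrT
      have h4 := CTree.dist_pt_le_radius hNrC hpick
      have h5 := CTree.dist_pt_le_radius hNrC hcr
      have h6 := CTree.radius_le ((scale_le_maxScale hNr).trans hM.le)
      have h7 := CTree.radius_le_of_lt (h.trans_le hM.le)
      have h8 := CTree.radius_le_of_lt ((scale_le_maxScale hN).trans_lt hmax)
      have h9 := dist_triangle Nq.pt c₀ (A.pick Nq Nr)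
      have h10 := dist_triangle_right c₀ (A.pick Nq Nr) Nr.pt
      have e : (2 : ℝ) ^ (M + 1) = 2 ^ M * 2 := zpow_add_one₀ two_ne_zero M
      linarith
  refine ⟨M, R', st', hM, htr, ?_, ?_, ?_, hmax, ?_, c₀, hc₀, hmin, hdist⟩
  · refine ⟨inv.mem, ⟨_, hR'sub⟩, ?_, fun _ => by rw [t2]; exact hv, t4 hval,
      fun Nr hNr => (t7 Nr hNr).2, ?_, fun N hN hne => ?_⟩
    · exact length_le_refBound hTr (CTree.points_subset inv.mem Nq.pt_mem_points) hmin hR'sub hdist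
    · rcases inv.covers with hdone | hcov
      · exact Or.inl (t6 (by unfold Done; rw [b2]; exact hdone)).2
      · refine t8 hval (Covers.of_perm ?_ hXp)
        rw [hM]
        exact hcov.expand hTr.1 inv.atLevel.mem_nodes M
    · rw [t2, b1]
      exact inv.fresh N hN hne
  · refine ⟨fun N hN => Or.inl ?_, fun N hN => ?_, fun hval' => t4 ?_⟩
    · rw [t2, b1] at hN; exact hN
    · rw [t3 N fun e => hN (e ▸ Nq.self_mem_nodes), b2]; rfl
    · unfold UbValid; rw [b3]; exact hval'
  · rw [t1, b4, hXp.length_eq]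
    simp only [State.tick]
    omega
  · exact htot.trans_lt (totalSize_expand_lt R (bot_le.trans_lt h))

end

section
-- Reference nodes near a query point
section Counting

variable {E : Type} [MetricSpace E]

open scoped Classical in
/-- The number of nodes of `T` whose points are within `ρ` of `q`. -/
noncomputable def nearCount (T : CTree E) (ρ : ℝ) (q : E) : ℕ :=
  T.nodes.countP fun N => dist q N.pt ≤ ρ

open scoped Classical in
/-- The number of nodes of `T` of scale at most `m` whose points are within `ρ` of `q`. -/
noncomputable def nearCountLE (T : CTree E) (ρ : ℝ) (q : E) (m : WithBot ℤ) : ℕ :=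
  T.nodes.countP fun N => N.scale ≤ m ∧ dist q N.pt ≤ ρ

theorem nearCountLE_le (T : CTree E) (ρ : ℝ) (q : E) (m : WithBot ℤ) :
    nearCountLE T ρ q m ≤ nearCount T ρ q :=
  List.countP_mono_left fun N _ h => by simp only [decide_eq_true_eq] at *; exact h.2

theorem countP_lt_countP {α : Type*} {p p' : α → Bool} {L : List α} (h : ∀ a ∈ L, p a → p' a) {a : α}
    (ha : a ∈ L) (h1 : ¬ p a) (h2 : p' a) : L.countP p < L.countP p' := by
  induction L with
  | nil => simp at ha
  | cons b L ih =>
    rw [List.countP_cons, List.countP_cons]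
    rcases List.mem_cons.1 ha with rfl | ha
    · rw [if_neg h1, if_pos h2]
      have := List.countP_mono_left fun b hb => h b (List.mem_cons_of_mem a hb)
      omega
    · have h3 := ih (fun c hc => h c (List.mem_cons_of_mem b hc)) ha
      have h4 := h b (by simp)
      split_ifs <;> first | omega | (exfalso; tauto)

/-- This makes `nearCountLE` a potential: the nearby node `N` is lost when the threshold falls below
its scale. -/
theorem nearCountLE_lt {T : CTree E} {ρ : ℝ} {q : E} {m m' : WithBot ℤ} (h : m' < m) {N : CTree E}
    (hN : N ∈ T.nodes) (hs : N.scale = m) (hd : dist q N.pt ≤ ρ) :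
    nearCountLE T ρ q m' < nearCountLE T ρ q m := by
  refine countP_lt_countP (fun a _ ha => ?_) hN ?_ ?_
  · simp only [decide_eq_true_eq] at *
    exact ⟨ha.1.trans h.le, ha.2⟩
  · simp only [decide_eq_true_eq, hs]
    exact fun h' => absurd h'.1 h.not_ge
  · simp only [decide_eq_true_eq]
    exact ⟨hs.le, hd⟩

theorem countP_le_one_of_pairwise {α : Type*} {p : α → Bool} {L : List α}
    (h : L.Pairwise fun a b => ¬ (p a ∧ p b)) : L.countP p ≤ 1 := by
  induction L with
  | nil => simp
  | cons a L ih =>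
    rw [List.pairwise_cons] at h
    rw [List.countP_cons]
    split_ifs with ha
    · rw [List.countP_eq_zero.2 fun b hb hpb => h.1 b hb ⟨ha, hpb⟩]
    · exact ih h.2

/-- The balls of radius `ρ` about the points of `L` are disjoint, so each node is counted at most
once. -/
theorem sum_nearCount_le (T : CTree E) {ρ : ℝ} {L : List E}
    (hL : L.Pairwise fun x y => 2 * ρ < dist x y) : (L.map (nearCount T ρ)).sum ≤ T.size := by
  classical
  rw [← CTree.length_nodes]
  unfold nearCount
  generalize T.nodes = M
  induction M with
  | nil => simp
  | cons a M ih =>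
    have e : (L.map fun q => (a :: M).countP fun N => decide (dist q N.pt ≤ ρ)).sum =
        (L.map fun q => M.countP fun N => decide (dist q N.pt ≤ ρ)).sum +
          L.countP fun q => decide (dist q a.pt ≤ ρ) := by
      clear ih hL
      induction L with
      | nil => simp
      | cons b L ih =>
        simp only [List.map_cons, List.sum_cons, List.countP_cons] at ih ⊢
        rw [ih]
        omega
    have h1 : (L.countP fun q => decide (dist q a.pt ≤ ρ)) ≤ 1 := by
      refine countP_le_one_of_pairwise (hL.imp fun {x y} h h' => ?_)
      simp only [decide_eq_true_eq] at h'
      have := dist_triangle_right x y a.pt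
      linarith
    rw [e, List.length_cons]
    omega

end Counting

/-! ### The unit of time -/

section Time

variable {E : Type} [MetricSpace E] {Tq Tr : CTree E}

/-- The bound on the time of one call of `traverse`, without the recursive calls. -/
noncomputable def callBound (S C : Finset E) : ℝ :=
  121 * (expansionConstant C ^ 4 * jointExpansionConstant S C ^ 5)

theorem callBound_spec (S C : Finset E) :
    1 ≤ callBound S C ∧ refBound S C ≤ callBound S C ∧
      1 + 3 * refBound S C + 9 * expansionConstant C ^ 3 * refBound S C ≤ callBound S C ∧
      27 * jointExpansionConstant S C ^ 4 ≤ callBound S C := by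
  have h1 := two_le_expansionConstant C
  have h2 := expansionConstant_le_joint S C
  have h0 := one_le_refBound S C
  unfold callBound
  set c := expansionConstant C
  set e := jointExpansionConstant S C
  have hc : 1 ≤ c := by linarith
  have he : 1 ≤ e := by linarith
  have a1 : 1 ≤ c ^ 3 := one_le_pow₀ hc
  -- The term `9 * c ^ 9` is split as `c ^ 4 * c ^ 5` and `c ≤ e` is applied to the second factor.
  -- The constant 121 is then `1 + 3 * 10 + 9 * 10`.
  have key : c ^ 3 * refBound S C ≤ 10 * (c ^ 4 * e ^ 5) := by
    have h3 : c ^ 4 * c ^ 5 ≤ c ^ 4 * e ^ 5 := by gcongr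
    have h4 : c ^ 3 * e ^ 3 ≤ c ^ 4 * e ^ 5 := by
      gcongr <;> first | assumption | norm_num
    calc c ^ 3 * refBound S C = 9 * (c ^ 4 * c ^ 5) + c ^ 3 * e ^ 3 := by
          rw [refBound]; ring
      _ ≤ _ := by linarith
  have h5 : refBound S C ≤ c ^ 3 * refBound S C := by nlinarith
  have h6 : e ^ 4 ≤ c ^ 4 * e ^ 5 := by
    have b1 : 1 ≤ c ^ 4 := one_le_pow₀ hc
    have b2 : e ^ 4 ≤ e ^ 5 := pow_le_pow_right₀ he (by norm_num)
    have b3 : 0 ≤ e ^ 5 := by positivity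
    nlinarith
  have h7 : 1 ≤ e ^ 4 := one_le_pow₀ he
  refine ⟨?_, ?_, ?_, ?_⟩ <;> nlinarith

/-- From `st`, the state `st'` is reached in the course of processing the subtree `Nq`, in time at
most `b` times the bound for one call. -/
def Within (Tq Tr Nq : CTree E) (st st' : State E) (b : ℝ) : Prop :=
  Frame Tq Tr.points Nq st st' ∧
    (st'.steps : ℝ) ≤ st.steps + callBound Tq.points Tr.points * b

theorem Within.mono {Nq : CTree E} {st st' : State E} {b b' : ℝ} (h : Within Tq Tr Nq st st' b)
    (hb : b ≤ b') : Within Tq Tr Nq st st' b' := by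
  refine ⟨h.1, h.2.trans ?_⟩
  have := (callBound_spec Tq.points Tr.points).1
  gcongr

theorem Within.trans {Nq : CTree E} {st st' st'' : State E} {b b' : ℝ}
    (h : Within Tq Tr Nq st st' b) (h' : Within Tq Tr Nq st' st'' b') :
    Within Tq Tr Nq st st'' (b + b') := by
  refine ⟨h.1.trans h'.1, h'.2.trans ?_⟩
  have := h.2
  rw [mul_add]
  linarith

end Time

/-! ### The number of reference recursions at one query node -/

section Cost

variable {E : Type} [NormedAddCommGroup E] [InnerProductSpace ℝ E] {Tq Tr : CTree E}

variable {A : Implementation Tq Tr} {k : ℕ}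

theorem callTime_le (hTr : Tr.IsCoverTree Tr.points) {Nq : CTree E} {R : List (CTree E)}
    {st : State E} (inv : Inv A k Nq R st) (m : WithBot ℤ) :
    ((1 + 3 * R.length + (expand m R).length : ℕ) : ℝ) ≤ callBound Tq.points Tr.points := by
  have h1 := length_expand_le hTr m inv.atLevel.mem_nodes
  have h2 := inv.length_le
  have h3 := (callBound_spec Tq.points Tr.points).2.2.1
  have h4 := two_le_expansionConstant Tr.points
  have h5 : 9 * expansionConstant Tr.points ^ 3 * R.length ≤
      9 * expansionConstant Tr.points ^ 3 * refBound Tq.points Tr.points := by gcongr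
  push_cast
  linarith

/-- A version of `traverse_step` that counts time in calls. -/
theorem within_step (hTr : Tr.IsCoverTree Tr.points) {Nq : CTree E} {R : List (CTree E)}
    {st : State E} (inv : Inv A k Nq R st) (h : Nq.scale < maxScale R) (par : Option (CTree E)) :
    ∃ (M : ℤ) (R' : List (CTree E)) (st' : State E), maxScale R = (M : WithBot ℤ) ∧
      traverse A k par Nq R st = traverse A k par Nq R' st' ∧ Inv A k Nq R' st' ∧
      Within Tq Tr Nq st st' 1 ∧ maxScale R' < (M : WithBot ℤ) ∧ totalSize R' < totalSize R ∧
      ∃ c₀ ∈ Tr.points, (∀ c ∈ Tr.points, dist Nq.pt c₀ ≤ dist Nq.pt c) ∧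
        ∀ N ∈ R', dist Nq.pt N.pt ≤ dist Nq.pt c₀ + 7 * 2 ^ M := by
  obtain ⟨M, R', st', h1, h2, h3, h4, h5, h6, h7, h8⟩ := traverse_step A k hTr inv h par
  refine ⟨M, R', st', h1, h2, h3, ⟨h4, ?_⟩, h6, h7, h8⟩
  have := callTime_le hTr inv (maxScale R)
  rw [h5, Nat.cast_add]
  linarith

theorem traverse_leaf_final (hTr : Tr.IsCoverTree Tr.points) {p : E} {R : List (CTree E)}
    {st : State E} (inv : Inv A k (.leaf p) R st) (h : ¬ (CTree.leaf p).scale < maxScale R)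
    (par : Option (CTree E)) :
    Frame Tq Tr.points (.leaf p) st (traverse A k par (.leaf p) R st) ∧
    (traverse A k par (.leaf p) R st).steps = st.steps + (1 + 3 * R.length) ∧
    Within Tq Tr (.leaf p) st (traverse A k par (.leaf p) R st) 1 := by
  obtain ⟨b1, b2, b3, b4⟩ := baseCases_spec (.leaf p) R (st.tick (1 + 2 * R.length))
  rw [traverse_leaf A k par h]
  have hf : Frame Tq Tr.points (.leaf p) st
      (baseCases (.leaf p) R (st.tick (1 + 2 * R.length))) := Frame.of_eq b1 b2 b3
  have hs : (baseCases (.leaf p) R (st.tick (1 + 2 * R.length))).steps =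
      st.steps + (1 + 3 * R.length) := by
    rw [b4]; simp only [State.tick]; omega
  refine ⟨hf, hs, hf, ?_⟩
  have h1 := callTime_le hTr inv ⊥
  rw [hs]
  push_cast at h1 ⊢
  have : (0 : ℝ) ≤ (expand ⊥ R).length := by positivity
  linarith

/-- Each recursion lowers `totalSize`, and a call costs at most `1 + 4 * t`. This crude quadratic
bound serves only when few reference nodes are left. -/
theorem traverse_leaf_totalSize (hTr : Tr.IsCoverTree Tr.points) {p : E} (par : Option (CTree E))
    (t : ℕ) : ∀ (R : List (CTree E)) (st : State E), Inv A k (.leaf p) R st → totalSize R ≤ t →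
      Frame Tq Tr.points (.leaf p) st (traverse A k par (.leaf p) R st) ∧
      (traverse A k par (.leaf p) R st).steps ≤ st.steps + (1 + 4 * t) * (t + 1) := by
  induction t with
  | zero =>
    intro R st inv ht
    have hR : R = [] := by
      have := length_le_totalSize R
      exact List.eq_nil_of_length_eq_zero (by omega)
    subst hR
    rw [traverse_nil]
    exact ⟨Frame.of_eq rfl rfl rfl, le_rfl⟩
  | succ t ih =>
    intro R st inv ht
    by_cases h : (CTree.leaf p).scale < maxScale R
    · obtain ⟨M, R', st', h1, h2, h3, h4, h5, h6, h7, _⟩ := traverse_step A k hTr inv h par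
      obtain ⟨i1, i2⟩ := ih R' st' h3 (by omega)
      rw [h2]
      refine ⟨h4.trans i1, ?_⟩
      have a1 := length_le_totalSize R
      have a2 := length_le_totalSize (expand (maxScale R) R)
      have a3 := totalSize_expand_lt R (bot_le.trans_lt h)
      nlinarith
    · obtain ⟨h1, h2, _⟩ := traverse_leaf_final hTr inv h par
      refine ⟨h1, ?_⟩
      have a1 := length_le_totalSize R
      nlinarith

/-- Far from the centroids `totalSize R` is at most `2 * e ^ 2`, so the quadratic bound gives `27 *
e ^ 4`, which is within the budget of a single call. -/
theorem traverse_leaf_far (hTr : Tr.IsCoverTree Tr.points) {p : E} (par : Option (CTree E))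
    {R : List (CTree E)} {st : State E} (inv : Inv A k (.leaf p) R st) {M : ℤ}
    (hM : maxScale R < (M : WithBot ℤ)) {c₀ : E}
    (hmin : ∀ c ∈ Tr.points, dist p c₀ ≤ dist p c)
    (hd : ∀ N ∈ R, dist p N.pt ≤ dist p c₀ + 7 * 2 ^ M) (hD : 8 * 2 ^ M ≤ dist p c₀) :
    Within Tq Tr (.leaf p) st (traverse A k par (.leaf p) R st) 1 := by
  obtain ⟨h1, h2⟩ := traverse_leaf_totalSize hTr par _ R st inv le_rfl
  refine ⟨h1, ?_⟩
  have hp : p ∈ Tq.points := CTree.points_subset inv.mem (CTree.leaf p).pt_mem_points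
  have h3 := totalSize_le_joint hTr hp hmin inv.atLevel hM hd hD
  have h4 := (callBound_spec Tq.points Tr.points).2.2.2
  have h5 := two_le_expansionConstant Tr.points
  have h6 := expansionConstant_le_joint Tq.points Tr.points
  set e := jointExpansionConstant Tq.points Tr.points
  have h7 : (1 : ℝ) ≤ e ^ 2 := one_le_pow₀ (by linarith)
  have h8 : ((traverse A k par (.leaf p) R st).steps : ℝ) ≤
      st.steps + (1 + 4 * totalSize R) * (totalSize R + 1) := by exact_mod_cast h2
  have h9 : (1 + 4 * (totalSize R : ℝ)) * (totalSize R + 1) ≤ (9 * e ^ 2) * (3 * e ^ 2) := by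
    gcongr <;> linarith
  have h10 : (9 * e ^ 2) * (3 * e ^ 2) = 27 * e ^ 4 := by ring
  linarith

/-- At low scales a recursion is charged to a node of largest scale in `R`, which is near `p` and is
lost from `nearCountLE`. Either the next list is again near, since `8 + 7 < 2 ^ 4`, or `p` is far
from the centroids and one more unit pays for the rest. -/
theorem traverse_leaf_low (hTr : Tr.IsCoverTree Tr.points) {p : E} (par : Option (CTree E))
    (L : ℤ) (t : ℕ) : ∀ (R : List (CTree E)) (st : State E), Inv A k (.leaf p) R st →
      nearCountLE Tr (2 ^ (L + 4)) p (maxScale R) ≤ t → maxScale R ≤ (L : WithBot ℤ) →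
      (∀ N ∈ R, dist p N.pt ≤ 2 ^ (L + 4)) →
      Within Tq Tr (.leaf p) st (traverse A k par (.leaf p) R st) (2 + t) := by
  induction t with
  | zero =>
    intro R st inv ht hL hd
    by_cases h : (CTree.leaf p).scale < maxScale R
    · exfalso
      obtain ⟨N, hN, hs⟩ := exists_scale_eq_maxScale R (bot_le.trans_lt h)
      have := nearCountLE_lt (T := Tr) (q := p) h (inv.atLevel.mem_nodes N hN) hs (hd N hN)
      omega
    · exact (traverse_leaf_final hTr inv h par).2.2.mono (by norm_num)
  | succ t ih =>
    intro R st inv ht hL hd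
    have ht0 : (0 : ℝ) ≤ t := by positivity
    by_cases h : (CTree.leaf p).scale < maxScale R
    · obtain ⟨N, hN, hs⟩ := exists_scale_eq_maxScale R (bot_le.trans_lt h)
      obtain ⟨M, R', st', h1, h2, h3, h4, h5, h6, c₀, hc₀, hmin, hdist⟩ :=
        within_step hTr inv h par
      simp only [show (CTree.leaf p).pt = p from rfl] at hmin hdist
      rw [h2]
      by_cases hD : 8 * 2 ^ M ≤ dist p c₀
      · refine (h4.trans (traverse_leaf_far hTr par h3 h5 hmin hdist hD)).mono ?_
        push_cast
        linarith
      · have hlt := nearCountLE_lt (T := Tr) (q := p) (m' := maxScale R') (h1 ▸ h5)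
          (inv.atLevel.mem_nodes N hN) hs (hd N hN)
        refine (h4.trans (ih R' st' h3 (by omega) (h5.le.trans (h1 ▸ hL)) fun N hN => ?_)).mono ?_
        · have hML : M ≤ L := WithBot.coe_le_coe.1 (h1 ▸ hL)
          have e1 : (2 : ℝ) ^ M ≤ 2 ^ L := zpow_le_zpow_right₀ one_le_two hML
          have e2 : (2 : ℝ) ^ (L + 4) = 2 ^ L * 16 := by
            rw [zpow_add₀ two_ne_zero]; norm_num
          have := hdist N hN
          have : (0 : ℝ) < 2 ^ L := by positivity
          linarith
        · push_cast; linarith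
    · exact (traverse_leaf_final hTr inv h par).2.2.mono (by push_cast; linarith)

/-- Each of the `n` levels above `L` costs at most one call. The list need not be near `p` on
arrival at `L`; one further recursion either makes it so or reaches the far case, whence 3 instead
of 2. -/
theorem traverse_leaf_within (hTr : Tr.IsCoverTree Tr.points) {p : E} (par : Option (CTree E))
    (L : ℤ) (n : ℕ) : ∀ (R : List (CTree E)) (st : State E), Inv A k (.leaf p) R st →
      maxScale R ≤ ((L + n : ℤ) : WithBot ℤ) →
      Within Tq Tr (.leaf p) st (traverse A k par (.leaf p) R st)
        (3 + nearCount Tr (2 ^ (L + 4)) p + n) := by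
  have hg : (0 : ℝ) ≤ nearCount Tr (2 ^ (L + 4)) p := by positivity
  induction n with
  | zero =>
    intro R st inv hL
    simp only [Nat.cast_zero, add_zero] at hL ⊢
    by_cases h : (CTree.leaf p).scale < maxScale R
    · obtain ⟨M, R', st', h1, h2, h3, h4, h5, h6, c₀, hc₀, hmin, hdist⟩ :=
        within_step hTr inv h par
      simp only [show (CTree.leaf p).pt = p from rfl] at hmin hdist
      rw [h2]
      by_cases hD : 8 * 2 ^ M ≤ dist p c₀
      · refine (h4.trans (traverse_leaf_far hTr par h3 h5 hmin hdist hD)).mono ?_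
        linarith
      · refine (h4.trans (traverse_leaf_low hTr par L _ R' st' h3 (nearCountLE_le _ _ _ _)
          (h5.le.trans (h1 ▸ hL)) fun N hN => ?_)).mono ?_
        · have hML : M ≤ L := WithBot.coe_le_coe.1 (h1 ▸ hL)
          have e1 : (2 : ℝ) ^ M ≤ 2 ^ L := zpow_le_zpow_right₀ one_le_two hML
          have e2 : (2 : ℝ) ^ (L + 4) = 2 ^ L * 16 := by
            rw [zpow_add₀ two_ne_zero]; norm_num
          have := hdist N hN
          have : (0 : ℝ) < 2 ^ L := by positivity
          linarith
        · linarith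
    · exact (traverse_leaf_final hTr inv h par).2.2.mono (by linarith)
  | succ n ih =>
    intro R st inv hL
    have hn : (0 : ℝ) ≤ n := by positivity
    push_cast at hL ⊢
    by_cases h : (CTree.leaf p).scale < maxScale R
    · obtain ⟨M, R', st', h1, h2, h3, h4, h5, h6, _⟩ := within_step hTr inv h par
      rw [h2]
      have hML : M ≤ L + (n + 1) := WithBot.coe_le_coe.1 (h1 ▸ hL)
      refine (h4.trans (ih R' st' h3 ?_)).mono (by linarith)
      cases hR' : maxScale R' with
      | bot => exact bot_le
      | coe m =>
        rw [hR'] at h5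
        have := WithBot.coe_lt_coe.1 h5
        exact WithBot.coe_le_coe.2 (by omega)
    · exact (traverse_leaf_final hTr inv h par).2.2.mono (by linarith)

/-- Each recursion lowers the largest reference scale by at least one, until it is at most `s`. -/
theorem traverse_scale_within (hTr : Tr.IsCoverTree Tr.points) {p : E} {s : ℤ} {m : ℕ}
    {ch : Fin m → CTree E} (par : Option (CTree E)) {b : ℝ}
    (hb : ∀ R st, Inv A k (.node p s m ch) R st → ¬ (CTree.node p s m ch).scale < maxScale R →
      Within Tq Tr (.node p s m ch) st (traverse A k par (.node p s m ch) R st) b) (n : ℕ) :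
    ∀ (R : List (CTree E)) (st : State E), Inv A k (.node p s m ch) R st →
      maxScale R ≤ ((s + n : ℤ) : WithBot ℤ) →
      Within Tq Tr (.node p s m ch) st (traverse A k par (.node p s m ch) R st) (b + n) := by
  induction n with
  | zero =>
    intro R st inv hR
    simp only [Nat.cast_zero, add_zero] at hR ⊢
    exact hb R st inv hR.not_gt
  | succ n ih =>
    intro R st inv hR
    have hn : (0 : ℝ) ≤ n := by positivity
    push_cast at hR ⊢
    by_cases h : (CTree.node p s m ch).scale < maxScale R
    · obtain ⟨M, R', st', h1, h2, h3, h4, h5, h6, _⟩ := within_step hTr inv h par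
      rw [h2]
      have hML : M ≤ s + (n + 1) := WithBot.coe_le_coe.1 (h1 ▸ hR)
      refine (h4.trans (ih R' st' h3 ?_)).mono (by linarith)
      cases hR' : maxScale R' with
      | bot => exact bot_le
      | coe m =>
        rw [hR'] at h5
        have := WithBot.coe_lt_coe.1 h5
        exact WithBot.coe_le_coe.2 (by omega)
    · exact (hb R st inv h).mono (by linarith)

/-- This is for the query root, where no parent's scale bounds that of the reference nodes. -/
theorem traverse_totalSize_within (hTr : Tr.IsCoverTree Tr.points) {Nq : CTree E}
    (par : Option (CTree E)) {b : ℝ}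
    (hb : ∀ R st, Inv A k Nq R st → ¬ Nq.scale < maxScale R →
      Within Tq Tr Nq st (traverse A k par Nq R st) b) (n : ℕ) :
    ∀ (R : List (CTree E)) (st : State E), Inv A k Nq R st → totalSize R ≤ n →
      Within Tq Tr Nq st (traverse A k par Nq R st) (b + n) := by
  induction n with
  | zero =>
    intro R st inv hR
    have hR0 : R = [] := by
      have := length_le_totalSize R
      exact List.eq_nil_of_length_eq_zero (by omega)
    rw [Nat.cast_zero, add_zero]
    exact hb R st inv (by simp [hR0, maxScale])
  | succ n ih =>
    intro R st inv hR
    have hn : (0 : ℝ) ≤ n := by positivity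
    push_cast
    by_cases h : Nq.scale < maxScale R
    · obtain ⟨M, R', st', h1, h2, h3, h4, h5, h6, _⟩ := within_step hTr inv h par
      rw [h2]
      exact (h4.trans (ih R' st' h3 (by omega))).mono (by linarith)
    · exact (hb R st inv h).mono (by linarith)

end Cost

end

section
-- Query recursions
section Score

variable {E : Type} [MetricSpace E] {Tq Tr : CTree E} {A : Implementation Tq Tr} {k : ℕ}

/-- Scoring a child of a query node for the first time. -/
theorem score_child {P N : CTree E} (hP : P ∈ Tq.nodes)
    (hN : N ∈ P.nodes) {R : List (CTree E)} (hR : R ≠ []) (hat : AtLevel Tr R)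
    (hlen : (R.length : ℝ) ≤ refBound Tq.points Tr.points) {st : State E}
    (hval : UbValid Tq Tr.points st) (hcov : Done k P st ∨ Covers Tr.points P R)
    (hfresh : ∀ M ∈ N.nodes, M ∉ st.visited) :
    Inv A k N (scoreAll A k (some P) N (A.order N R) st).1
        (scoreAll A k (some P) N (A.order N R) st).2 ∧
      Within Tq Tr N st (scoreAll A k (some P) N (A.order N R) st).2 1 := by
  have hNT : N ∈ Tq.nodes := CTree.mem_nodes_trans hP hN
  have hperm := A.order_perm N R
  have hne : A.order N R ≠ [] := fun h => hR (by rw [h] at hperm; exact hperm.nil_eq.symm)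
  rw [← scoreAll_enter A k (some P) N hne]
  obtain ⟨e1, e2, e3, e4, e5, -⟩ := enter_spec (some P) N st
  set st₁ := enter (some P) N st
  have hv : N ∈ st₁.visited := by rw [e3]; exact Set.mem_insert _ _
  have hat' := hat.perm hperm
  obtain ⟨t1, t2, t3, t4, t5, t6, t7, t8⟩ := scoreAll_spec A k (some P) hNT hat'.mem_nodes hv
  have hsl := scoreAll_sublist A k (some P) N (A.order N R) st₁
  set R' := (scoreAll A k (some P) N (A.order N R) st₁).1
  set st' := (scoreAll A k (some P) N (A.order N R) st₁).2
  have hval₁ : UbValid Tq Tr.points st₁ := by unfold UbValid; rw [e2]; exact hval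
  refine ⟨⟨hNT, hat'.sublist hsl, ?_, fun _ => by rw [t2]; exact hv, t4 hval₁,
    fun Nr hNr => (t7 Nr hNr).2, ?_, fun M hM hne' => ?_⟩, ⟨fun M hM => ?_, fun M hM => ?_,
      fun h => t4 (by unfold UbValid; rw [e2]; exact h)⟩, ?_⟩
  · have h1 : R'.length ≤ R.length := hperm.length_eq ▸ hsl.length_le
    exact le_trans (by exact_mod_cast h1) hlen
  · rcases hcov with hdone | hcov
    · refine Or.inl (t6 ?_).2
      unfold Done
      rw [e5 P rfl (hfresh N N.self_mem_nodes)]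
      exact hdone
    · exact t8 hval₁ ((hcov.of_mem hN).of_perm hperm)
  · rw [t2, e3]
    rintro (h | h)
    · exact hne' h
    · exact hfresh M hM h
  · rw [t2, e3] at hM
    rcases hM with rfl | h
    · exact Or.inr M.self_mem_nodes
    · exact Or.inl h
  · have : M ≠ N := fun e => hM (e ▸ N.self_mem_nodes)
    rw [t3 M this, e4 M this]
  · have := (callBound_spec Tq.points Tr.points).2.1
    rw [t1, e1, hperm.length_eq]
    push_cast
    linarith

/-- Two facts persist through the loop: the parent stays done or covered, and later siblings stay
unvisited, so that each inherits the parent's pruned set. Both hold because processing a child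
prunes and marks only inside its subtree, and the subtrees are disjoint. -/
theorem foldl_children_within (hTq : Tq.IsCoverTree Tq.points) {p : E} {s : ℤ} {n : ℕ}
    {ch : Fin n → CTree E} (hP : CTree.node p s n ch ∈ Tq.nodes) {b : Fin n → ℝ}
    (hb : ∀ i R st, Inv A k (ch i) R st → maxScale R ≤ (s : WithBot ℤ) →
      Within Tq Tr (ch i) st (traverse A k (some (.node p s n ch)) (ch i) R st) (b i))
    {R : List (CTree E)} (hR : R ≠ []) (hat : AtLevel Tr R) (hs : maxScale R ≤ (s : WithBot ℤ))
    (hlen : (R.length : ℝ) ≤ refBound Tq.points Tr.points) (l : List (Fin n)) :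
    l.Nodup → ∀ st : State E, UbValid Tq Tr.points st →
      (Done k (.node p s n ch) st ∨ Covers Tr.points (.node p s n ch) R) →
      (∀ i ∈ l, ∀ N ∈ (ch i).nodes, N ∉ st.visited) →
      Within Tq Tr (.node p s n ch) st
        (l.foldl (fun st i =>
          traverse A k (some (.node p s n ch)) (ch i)
            (scoreAll A k (some (.node p s n ch)) (ch i) (A.order (ch i) R) st).1
            (scoreAll A k (some (.node p s n ch)) (ch i) (A.order (ch i) R) st).2) st)
        ((l.map fun i => 1 + b i).sum) := by
  induction l with
  | nil =>
    intro _ st _ _ _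
    exact ⟨Frame.of_eq rfl rfl rfl, by simp⟩
  | cons i l ih =>
    intro hl st hval hcov hfresh
    rw [List.nodup_cons] at hl
    obtain ⟨inv, w₁⟩ := score_child (A := A) hP (CTree.child_mem_nodes i) hR hat hlen hval hcov
      (hfresh i (by simp))
    have hs' : maxScale (scoreAll A k (some (.node p s n ch)) (ch i) (A.order (ch i) R) st).1 ≤
        (s : WithBot ℤ) := maxScale_le fun N hN => (scale_le_maxScale
          ((A.order_perm _ _).subset ((scoreAll_sublist _ _ _ _ _ _).subset hN))).trans hs
    have w₂ := w₁.trans (hb i _ _ inv hs')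
    rw [List.foldl_cons, List.map_cons, List.sum_cons]
    refine Within.trans ⟨w₂.1.mono (CTree.child_mem_nodes i), w₂.2⟩
      (ih hl.2 _ (w₂.1.ubValid hval) ?_ fun j hj N hN hv => ?_)
    · rcases hcov with hdone | hcov
      · refine Or.inl ?_
        unfold Done
        rw [w₂.1.pruned _ (CTree.notMem_nodes_child i)]
        exact hdone
      · exact Or.inr hcov
    · rcases w₂.1.visited N hv with h | h
      · exact hfresh j (by simp [hj]) N hN h
      · exact CTree.disjoint_nodes_children hTq hP (i := j) (j := i)
          (fun e => hl.1 (e ▸ hj)) hN h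

end Score

section Recursion

variable {E : Type} [NormedAddCommGroup E] [InnerProductSpace ℝ E] {Tq Tr : CTree E}
  {A : Implementation Tq Tr} {k : ℕ}

theorem traverse_node_final (hTq : Tq.IsCoverTree Tq.points) (hTr : Tr.IsCoverTree Tr.points)
    {p : E} {s : ℤ} {n : ℕ} {ch : Fin n → CTree E} {b : Fin n → ℝ} (hb0 : ∀ i, 0 ≤ b i)
    (hb : ∀ i R st, Inv A k (ch i) R st → maxScale R ≤ (s : WithBot ℤ) →
      Within Tq Tr (ch i) st (traverse A k (some (.node p s n ch)) (ch i) R st) (b i))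
    (par : Option (CTree E)) {R : List (CTree E)} {st : State E}
    (inv : Inv A k (.node p s n ch) R st) (h : ¬ (CTree.node p s n ch).scale < maxScale R) :
    Within Tq Tr (.node p s n ch) st (traverse A k par (.node p s n ch) R st)
      (1 + ∑ i, (1 + b i)) := by
  have hsum : 0 ≤ ∑ i, (1 + b i) := Finset.sum_nonneg fun i _ => by linarith [hb0 i]
  by_cases hR : R = []
  · subst hR
    rw [traverse_nil]
    refine Within.mono ⟨Frame.of_eq rfl rfl rfl, ?_⟩ (le_add_of_nonneg_right hsum)
    have := (callBound_spec Tq.points Tr.points).1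
    simp only [State.tick]
    push_cast
    linarith
  · obtain ⟨b1, b2, b3, b4⟩ := baseCases_spec (.node p s n ch) R (st.tick (1 + 2 * R.length))
    rw [traverse_node A k par hR h]
    set st₁ := baseCases (.node p s n ch) R (st.tick (1 + 2 * R.length))
    have e : ∑ i, (1 + b i) = ((List.finRange n).map fun i => 1 + b i).sum := by
      rw [← List.sum_ofFn, List.ofFn_eq_map]
    rw [e]
    refine Within.trans (st' := st₁) ⟨Frame.of_eq b1 b2 b3, ?_⟩
      (foldl_children_within hTq inv.mem hb hR inv.atLevel (not_lt.1 h) inv.length_le _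
        (List.nodup_finRange n) st₁ ?_ ?_ fun i _ N hN => ?_)
    · have h1 := callTime_le hTr inv ⊥
      rw [b4]
      simp only [State.tick]
      push_cast at h1 ⊢
      have : (0 : ℝ) ≤ (expand ⊥ R).length := by positivity
      linarith
    · unfold UbValid; rw [b3]; exact inv.ubValid
    · refine inv.covers.imp_left fun hd => ?_
      unfold Done; rw [b2]; exact hd
    · rw [b1]
      refine inv.fresh N (CTree.mem_nodes_trans (CTree.child_mem_nodes i) hN) ?_
      rintro rfl
      exact CTree.notMem_nodes_child i hN

end Recursion

/-! ### Charging calls to the imbalance -/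

section Work

variable {E : Type}

/-- The number of calls charged to the reference recursions at a child of a node of scale `s`. -/
def recursionWork (L : ℤ) (g : E → ℕ) (s : ℤ) : CTree E → ℝ
  | .leaf p => 3 + g p + (s - L).toNat
  | .node _ t _ _ => (s - t).toNat

/-- The number of calls charged to a subtree, the reference recursions at its root excepted. -/
def work (L : ℤ) (g : E → ℕ) : CTree E → ℝ
  | .leaf _ => 1
  | .node _ s _ ch => 1 + ∑ i, (1 + (work L g (ch i) + recursionWork L g s (ch i)))

theorem recursionWork_nonneg (L : ℤ) (g : E → ℕ) (s : ℤ) (T : CTree E) :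
    0 ≤ recursionWork L g s T := by
  cases T <;> simp only [recursionWork] <;> positivity

theorem work_nonneg (L : ℤ) (g : E → ℕ) (T : CTree E) : 0 ≤ work L g T := by
  induction T with
  | leaf p => simp [work]
  | node p s n ch ih =>
    rw [work]
    have := Finset.sum_nonneg fun i (_ : i ∈ Finset.univ) =>
      add_nonneg zero_le_one (add_nonneg (ih i) (recursionWork_nonneg L g s (ch i)))
    linarith

/-- For a non-leaf child, the surplus 2 absorbs its scoring and the gap between `s - t` and its
imbalance `s - t - 1`. For a leaf child, 12 is one unit for scoring, one for the final call, 3 from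
`recursionWork`, and 7 because the count goes down to `smin - 6` while the imbalance stops at `smin
+ 1`. -/
theorem work_le [MetricSpace E] (smin : ℤ) (g : E → ℕ) {T : CTree E} (hT : T.NestedCovering) :
    work (smin - 6) g T + 2 ≤
      T.imbalanceBelow smin + 12 * T.size + ((T.leaves.map g).sum : ℕ) := by
  induction T with
  | leaf p =>
    have : (0 : ℝ) ≤ g p := by positivity
    simp only [work, CTree.imbalanceBelow, CTree.size, CTree.leaves, List.map_cons, List.map_nil,
      List.sum_cons, List.sum_nil]
    push_cast
    linarith
  | node p s n ch ih =>
    have key : ∀ i, 1 + (work (smin - 6) g (ch i) + recursionWork (smin - 6) g s (ch i)) ≤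
        ((CTree.nodeImbalance smin s (ch i) + (ch i).imbalanceBelow smin : ℤ) : ℝ) +
          12 * (ch i).size + (((ch i).leaves.map g).sum : ℕ) := by
      intro i
      have hi := ih i (hT.2.2.2.2 i)
      have hsc := hT.2.2.1 i
      cases hc : ch i with
      | leaf q =>
        have h1 : ((s - (smin - 6)).toNat : ℤ) ≤ max (s - smin - 1) 0 + 7 := by omega
        have h2 : (((s - (smin - 6)).toNat : ℕ) : ℝ) ≤ ((max (s - smin - 1) 0 : ℤ) : ℝ) + 7 := by
          exact_mod_cast h1
        simp only [work, recursionWork, CTree.nodeImbalance, CTree.imbalanceBelow, CTree.size,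
          CTree.leaves, List.map_cons, List.map_nil, List.sum_cons, List.sum_nil, add_zero]
        push_cast at h2 ⊢
        linarith
      | node q t m ch' =>
        rw [hc] at hi hsc
        have hts : t < s := WithBot.coe_lt_coe.1 hsc
        have h1 : ((s - t).toNat : ℤ) = s - t := Int.toNat_of_nonneg (by omega)
        have h2 : (((s - t).toNat : ℕ) : ℝ) = s - t := by exact_mod_cast h1
        simp only [recursionWork, CTree.nodeImbalance]
        push_cast at hi ⊢
        linarith
    have hsum := Finset.sum_le_sum fun i (_ : i ∈ Finset.univ) => key i
    rw [Finset.sum_add_distrib (s := Finset.univ) (g := fun i => ((((ch i).leaves.map g).sum : ℕ) : ℝ)),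
      Finset.sum_add_distrib (s := Finset.univ) (g := fun i => 12 * ((ch i).size : ℝ)),
      ← Finset.mul_sum] at hsum
    have e : (((CTree.node p s n ch).leaves.map g).sum) = ∑ i, ((ch i).leaves.map g).sum := by
      simp [CTree.leaves, List.map_flatten, List.sum_flatten, List.map_ofFn, List.sum_ofFn,
        Function.comp_def]
    rw [e, work, CTree.imbalanceBelow, CTree.size]
    push_cast at hsum ⊢
    linarith

end Work

/-! ### The total running time -/

section Total

variable {E : Type} [NormedAddCommGroup E] [InnerProductSpace ℝ E] {Tq Tr : CTree E}
  {A : Implementation Tq Tr} {k : ℕ}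

theorem traverse_within_work (hTq : Tq.IsCoverTree Tq.points) (hTr : Tr.IsCoverTree Tr.points)
    (L : ℤ) {T : CTree E} (hT : T ∈ Tq.nodes) :
    ∀ (par : Option (CTree E)) (R : List (CTree E)) (st : State E), Inv A k T R st →
      ¬ T.scale < maxScale R →
      Within Tq Tr T st (traverse A k par T R st) (work L (nearCount Tr (2 ^ (L + 4))) T) := by
  induction T with
  | leaf p =>
    intro par R st inv h
    exact (traverse_leaf_final hTr inv h par).2.2
  | node p s n ch ih =>
    intro par R st inv h
    rw [work]
    refine traverse_node_final hTq hTr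
      (fun i => add_nonneg (work_nonneg _ _ _) (recursionWork_nonneg _ _ _ _))
      (fun i R st inv hs => ?_) par inv h
    have ih' := ih i (CTree.mem_nodes_trans hT (CTree.child_mem_nodes i))
      (some (CTree.node p s n ch))
    have hsc := (hTq.1.of_mem_nodes hT).2.2.1 i
    revert inv ih' hsc
    cases ch i with
    | leaf q =>
      intro inv ih' hsc
      refine (traverse_leaf_within hTr _ L (s - L).toNat R st inv
        (hs.trans (WithBot.coe_le_coe.2 (by omega)))).mono ?_
      simp only [work, recursionWork]
      linarith
    | node q t m ch' =>
      intro inv ih' hsc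
      have hts : t < s := WithBot.coe_lt_coe.1 hsc
      exact traverse_scale_within hTr _ ih' (s - t).toNat R st inv
        (hs.trans (WithBot.coe_le_coe.2 (by omega)))

theorem runningTime_le (hTq : Tq.IsCoverTree Tq.points) (hTr : Tr.IsCoverTree Tr.points)
    (A : Implementation Tq Tr) (k : ℕ) (hk : Tr.points.card ≤ Tq.points.card) {st₀ : State E}
    (hst : st₀.Valid Tq Tr.points) :
    (runningTime A k st₀ : ℝ) ≤ callBound Tq.points Tr.points *
      (29 * ((Tq.points.card : ℝ) + (Tq.imbalance : ℝ))) := by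
  obtain ⟨hvis, -, hub⟩ := hst
  have hat : AtLevel Tr [Tr] := by
    cases hsc : Tr.scale with
    | bot => exact ⟨0, by rw [CTree.levelNodes_eq_self (by rw [hsc]; exact bot_le)]⟩
    | coe m => exact ⟨m, by rw [CTree.levelNodes_eq_self hsc.le]⟩
  have hself := Tq.self_mem_nodes
  unfold runningTime dualTreeStep
  dsimp only
  rw [← scoreAll_enter A k none Tq (by simp : [Tr] ≠ [])]
  obtain ⟨e1, e2, e3, -⟩ := enter_spec none Tq { st₀ with steps := 0 }
  set st₁ := enter none Tq { st₀ with steps := 0 }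
  have hv : Tq ∈ st₁.visited := by rw [e3]; exact Set.mem_insert _ _
  obtain ⟨t1, t2, t3, t4, t5, t6, t7, t8⟩ := scoreAll_spec A k none hself hat.mem_nodes hv
  have hsl := scoreAll_sublist A k none Tq [Tr] st₁
  set R' := (scoreAll A k none Tq [Tr] st₁).1
  set st' := (scoreAll A k none Tq [Tr] st₁).2
  have hval₁ : UbValid Tq Tr.points st₁ := by unfold UbValid; rw [e2]; exact hub
  have hW := (callBound_spec Tq.points Tr.points).1
  have inv : Inv A k Tq R' st' := by
    refine ⟨hself, hat.sublist hsl, ?_, fun _ => by rw [t2]; exact hv, t4 hval₁,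
      fun Nr hNr => (t7 Nr hNr).2, t8 hval₁ fun x _ c hc _ => ⟨Tr, by simp, hc⟩,
      fun M _ hne => ?_⟩
    · have h1 : (R'.length : ℝ) ≤ 1 := by exact_mod_cast hsl.length_le
      exact h1.trans (one_le_refBound _ _)
    · rw [t2, e3]
      rintro (h | h)
      · exact hne h
      · change M ∈ st₀.visited at h
        rw [hvis] at h
        exact h
  have htot : totalSize R' ≤ Tr.size := by
    simpa [totalSize] using totalSize_le_of_sublist hsl
  set L := Tq.minScale - 6
  have hmain := (traverse_totalSize_within hTr none
    (traverse_within_work (A := A) (k := k) hTq hTr L hself none) Tr.size R' st' inv htot).2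
  have hwork := work_le Tq.minScale (nearCount Tr (2 ^ (L + 4))) hTq.1
  -- The choice of `L` makes `2 * 2 ^ (L + 4)` exactly the separation `2 ^ (minScale - 1)` of the
  -- query leaves.
  have hnear := sum_nearCount_le Tr (ρ := 2 ^ (L + 4)) (L := Tq.leaves)
    (hTq.pairwise_leaves.imp fun {x y} h => by
      refine lt_of_le_of_lt ?_ h
      rw [← zpow_one_add₀ two_ne_zero]
      exact zpow_le_zpow_right₀ one_le_two (by omega))
  have hq : (Tq.size : ℝ) ≤ 2 * Tq.points.card := by exact_mod_cast hTq.size_le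
  have hr : (Tr.size : ℝ) ≤ 2 * Tq.points.card := by
    exact_mod_cast hTr.size_le.trans (Nat.mul_le_mul_left 2 hk)
  have hN : (1 : ℝ) ≤ Tq.points.card := by
    exact_mod_cast Finset.card_pos.2 ⟨_, Tq.pt_mem_points⟩
  have himb : (0 : ℝ) ≤ Tq.imbalance := by
    exact_mod_cast CTree.imbalanceBelow_nonneg hTq.1 Tq.minScale
  have hnear' : (((Tq.leaves.map (nearCount Tr (2 ^ (L + 4)))).sum : ℕ) : ℝ) ≤ Tr.size := by
    exact_mod_cast hnear
  have hst' : (st'.steps : ℝ) = 1 := by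
    rw [t1, e1]; simp
  have himb' : ((Tq.imbalanceBelow Tq.minScale : ℤ) : ℝ) = Tq.imbalance := rfl
  rw [hst'] at hmain
  rw [himb'] at hwork
  -- Besides the imbalance, `12 * Tq.size` gives `24 * N`, and the nearby reference nodes and the
  -- recursions at the root give `2 * N` each.
  have hsum : 1 + (work L (nearCount Tr (2 ^ (L + 4))) Tq + Tr.size) ≤
      29 * ((Tq.points.card : ℝ) + (Tq.imbalance : ℝ)) := by linarith
  have := mul_le_mul_of_nonneg_left hsum (zero_le_one.trans hW)
  rw [mul_add, mul_one] at this
  linarith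

end Total

end

end DualTreeKMeans

theorem mainTheorem3 :
    ∃ K : ℝ, 0 < K ∧
      ∀ (d : ℕ) (S C : Finset (EuclideanSpace ℝ (Fin d))),
        C.Nonempty → C.card ≤ S.card →
      ∀ Tq Tr : DualTreeKMeans.CTree (EuclideanSpace ℝ (Fin d)),
        Tq.IsCoverTree S → Tr.IsCoverTree C →
      ∀ (A : DualTreeKMeans.Implementation Tq Tr)
        (st₀ : DualTreeKMeans.State (EuclideanSpace ℝ (Fin d))),
        st₀.Valid Tq C →
        (DualTreeKMeans.runningTime A C.card st₀ : ℝ) ≤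
          K * (DualTreeKMeans.expansionConstant C ^ 4 *
            DualTreeKMeans.jointExpansionConstant S C ^ 5 *
            ((S.card : ℝ) + (Tq.imbalance : ℝ))) := by
  refine ⟨121 * 29, by norm_num, ?_⟩
  intro d S C _ hk Tq Tr hTq hTr A st₀ hst
  obtain rfl : Tq.points = S := hTq.2.2
  obtain rfl : Tr.points = C := hTr.2.2
  refine (DualTreeKMeans.runningTime_le hTq hTr A _ hk hst).trans (le_of_eq ?_)
  rw [DualTreeKMeans.callBound]
  ring
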